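/- Let $A$ be a finite totally ordered set, $A^*$ the free monoid on $A$, and $\Gamma(A)$ the set of columns, i.e. of subsets of $A$. For $a\in A$ and $\gamma\in\Gamma(A)$ let $a\cdot\gamma=(\gamma\setminus\{y\})\cup\{a\}$, where $y$ is the smallest element of $\gamma$ with $y\ge a$, if there is one, and $a\cdot\gamma=\gamma\cup\{a\}$ otherwise. This extends to a left action $(w,\gamma)\mapsto w\cdot\gamma$ of $A^*$ on $\Gamma(A)$; the stylic monoid $Styl(A)$ is the monoid of all endofunctions $\mu(w):\gamma\mapsto w\cdot\gamma$ of $\Gamma(A)$, $w\in A^*$. Words are also written for their images under $\mu$. The $N$-tableau $N(w)$ of a word $w$ is obtained from the empty tableau by inserting the letters of $w$ from left to right, where a letter $a$ is inserted as follows: $a$ is added to the bottom row, if it is not already there; if the bottom row contains letters larger than $a$, then the smallest of them stays in the bottom row and is also inserted, by the same rule, into the tableau formed by the rows above. (Each row is a set of letters, written in increasing order and left-justified.) The tableau $N(w)$ depends only on $x=\mu(w)$ and is denoted $N(x)$. Let $\eta(x)\in\Gamma(A)$ be the first column of $N(x)$ and let $w_x$ be the word such that $\eta(x)w_x$ is the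 column-reading word of $N(x)$ (columns from left to right, each read as a decreasing word); so $w_x$ is the word read from the columns other than the first one. Let $\theta$ be the order-reversing bijection of $A$, also applied to subsets of $A$ elementwise, and extended to the anti-automorphism of $A^*$; it induces an anti-automorphism $\theta$ of $Styl(A)$. Let $\mathbb K$ be a field and $\mathbb KStyl(A)$ the monoid algebra of $Styl(A)$. For $\gamma\in\Gamma(A)$ let $$e_\gamma=\prod^{\nearrow}_{a\notin\gamma}(1-a)\ \prod^{\searrow}_{a\in\gamma}a\ \in\ \mathbb KStyl(A),$$ where the first product is taken in increasing and the second in decreasing order of the letters. Then, for every $\gamma\in\Gamma(A)$: 1. the elements $e_{\eta(x)}w_x$, for $x\in Styl(A)$ with $\eta(x)=\gamma$, form a $\mathbb K$-basis of the right module $e_\gamma\,\mathbb KStyl(A)$; 2. the elements $e_{\eta(x)}w_x$, for $x\in Styl(A)$ with $\theta(\eta(\theta(x)))=\gamma$, form a $\mathbb K$-basis of the left module $\mathbb KStyl(A)\,e_\gamma$. -/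

import Mathlib

namespace Stylic

/-! ### Columns, column insertion and the left action

A column on the totally ordered alphabet `A` is a finite subset of `A`, i.e. a `Finset A`;
a word is a `List A`. -/

section Action

variable {A : Type*} [LinearOrder A]

/-- Schensted column insertion of the letter `a` into the column `γ`: the smallest letter of `γ`
that is `≥ a`, if there is one, is replaced by `a`; otherwise `a` is added. -/
def colInsert (a : A) (γ : Finset A) : Finset A :=
  if h : (γ.filter (fun y => a ≤ y)).Nonempty then
    insert a (γ.erase ((γ.filter (fun y => a ≤ y)).min' h))
  else insert a γ

/-- The left action `w · γ` of words on columns (the last letter of `w` is inserted first), seen as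
an element of the monoid of endofunctions of the set of columns. -/
def act (w : List A) : Function.End (Finset A) := fun γ => w.foldr colInsert γ

theorem act_nil (γ : Finset A) : act ([] : List A) γ = γ := rfl

theorem act_cons (a : A) (w : List A) (γ : Finset A) :
    act (a :: w) γ = colInsert a (act w γ) := rfl

theorem act_append (u v : List A) (γ : Finset A) : act (u ++ v) γ = act u (act v γ) := by
  simp [act, List.foldr_append]

variable (A) in
/-- The stylic monoid: all endofunctions `γ ↦ w · γ` of the set of columns, for words `w`,
under composition. -/
def Styl : Submonoid (Function.End (Finset A)) where
  carrier := Set.range act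
  one_mem' := ⟨[], rfl⟩
  mul_mem' := by
    rintro _ _ ⟨u, rfl⟩ ⟨v, rfl⟩
    exact ⟨u ++ v, funext fun γ => act_append u v γ⟩

/-- The class `μ(w)` of a word `w` in the stylic monoid. -/
def mu (w : List A) : Styl A := ⟨act w, w, rfl⟩

theorem mu_surjective : Function.Surjective (mu : List A → Styl A) := by
  rintro ⟨_, w, rfl⟩
  exact ⟨w, rfl⟩

theorem mu_append (u v : List A) : mu (u ++ v) = mu u * mu v :=
  Subtype.ext (funext fun γ => act_append u v γ)

theorem mu_eq_iff {u v : List A} : mu u = mu v ↔ ∀ γ, act u γ = act v γ :=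
  Subtype.ext_iff.trans funext_iff

end Action

/-! ### `N`-tableaux

A tableau with strictly increasing rows is the list of its rows, bottom row first, each row being
given by the set of its letters. -/

section NTableau

variable {A : Type*} [LinearOrder A]

/-- `N`-insertion of a letter `a` into an `N`-tableau: `a` is added to the bottom row (if it is not
there already); if that row has a letter larger than `a`, then the smallest such letter stays in its
row and is also inserted, in the same way, into the tableau formed by the rows above. -/
def nInsert : List (Finset A) → A → List (Finset A)
  | [], a => [{a}]
  | R :: T, a => insert a R ::
      (if h : (R.filter (fun y => a < y)).Nonempty then
        nInsert T ((R.filter (fun y => a < y)).min' h)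
      else T)

/-- The `N`-tableau of a word: its letters are inserted from left to right, starting with the empty
tableau. -/
def nTableau (w : List A) : List (Finset A) := w.foldl nInsert []

/-- The `j`-th column (counted from `0`) of a tableau given by its rows, read from bottom to top. -/
def tabColumn (T : List (Finset A)) (j : ℕ) : List A :=
  T.filterMap fun R => (R.sort (· ≤ ·))[j]?

/-- The number of columns of a tableau, i.e. the length of its bottom row. -/
def width : List (Finset A) → ℕ
  | [] => 0
  | R :: _ => R.card

/-- The first column of a tableau, as a set of letters. -/
def firstColumn (T : List (Finset A)) : Finset A := (tabColumn T 0).toFinset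

/-- The column-reading word of a tableau with its first column removed: the columns of index
`1, 2, …` are read from left to right, each one from top to bottom (as a decreasing word). -/
def restReading (T : List (Finset A)) : List A :=
  (List.range' 1 (width T - 1)).flatMap fun j => (tabColumn T j).reverse

end NTableau

/-! ### Reversal of the alphabet -/

section Reversal

variable {A : Type*} [Fintype A] [LinearOrder A]

/-- The order-reversing bijection of a finite totally ordered set. -/
def letterRev (a : A) : A :=
  Fintype.orderIsoFinOfCardEq A rfl (Fin.rev ((Fintype.orderIsoFinOfCardEq A rfl).symm a))

theorem letterRev_letterRev (a : A) : letterRev (letterRev a) = a := by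
  simp [letterRev]

theorem letterRev_lt {a b : A} : letterRev a < letterRev b ↔ b < a := by
  simp [letterRev]

/-- The anti-automorphism `θ` of the free monoid that reverses the order of the alphabet. -/
def wordTheta (w : List A) : List A := (w.map letterRev).reverse

/-- `θ` on columns, seen as sets of letters. -/
def colTheta (γ : Finset A) : Finset A := γ.image letterRev

end Reversal

/-! ### Compatibility with the stylic congruence

The `N`-tableau of a word and the class of `θ(w)` depend only on the class of `w` in the stylic
monoid. The proofs go through the lengths of strictly decreasing subwords. -/

section WellDefined

variable {A : Type*} [LinearOrder A]

/-- `w` has a strictly decreasing subword of length `k` with all letters in `p`. -/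
def Dec (w : List A) (p : A → Prop) (k : ℕ) : Prop :=
  ∃ s : List A, s.Sublist w ∧ s.Pairwise (· > ·) ∧ (∀ x ∈ s, p x) ∧ s.length = k

/-- `I` is closed under passing to smaller letters. -/
def Low (I : A → Prop) : Prop := ∀ x y, x ≤ y → I y → I x

theorem Dec.mono {w : List A} {p q : A → Prop} {k l : ℕ} (h : Dec w p k) (hpq : ∀ x, p x → q x)
    (hl : l ≤ k) : Dec w q l := by
  obtain ⟨s, h1, h2, h3, h4⟩ := h
  refine ⟨s.take l, (List.take_sublist _ _).trans h1, h2.sublist (List.take_sublist _ _),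
    fun x hx => hpq x (h3 x (List.mem_of_mem_take hx)), by simp; omega⟩

theorem Dec_cons {a : A} {w : List A} {p : A → Prop} {k : ℕ} :
    Dec (a :: w) p (k + 1) ↔ Dec w p (k + 1) ∨ (p a ∧ Dec w (fun x => p x ∧ x < a) k) := by
  constructor
  · rintro ⟨s, h1, h2, h3, h4⟩
    rcases List.sublist_cons_iff.1 h1 with h | ⟨r, rfl, hr⟩
    · exact Or.inl ⟨s, h, h2, h3, h4⟩
    · rw [List.pairwise_cons] at h2
      exact Or.inr ⟨h3 a (by simp), r, hr, h2.2,
        fun x hx => ⟨h3 x (by simp [hx]), h2.1 x hx⟩, by simpa using h4⟩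
  · rintro (⟨s, h1, h2, h3, h4⟩ | ⟨ha, s, h1, h2, h3, h4⟩)
    · exact ⟨s, h1.cons a, h2, h3, h4⟩
    · refine ⟨a :: s, h1.cons_cons a, List.pairwise_cons.2 ⟨fun x hx => (h3 x hx).2, h2⟩, ?_,
        by simp [h4]⟩
      intro x hx
      rcases List.mem_cons.1 hx with rfl | hx
      · exact ha
      · exact (h3 x hx).1

theorem Dec_concat {a : A} {w : List A} {p : A → Prop} {k : ℕ} :
    Dec (w ++ [a]) p (k + 1) ↔ Dec w p (k + 1) ∨ (p a ∧ Dec w (fun x => p x ∧ a < x) k) := by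
  constructor
  · rintro ⟨s, h1, h2, h3, h4⟩
    obtain ⟨s1, s2, rfl, hs1, hs2⟩ := List.sublist_append_iff.1 h1
    rcases List.sublist_cons_iff.1 hs2 with h | ⟨r, rfl, hr⟩
    · rw [List.sublist_nil] at h
      subst h
      exact Or.inl ⟨s1, hs1, by simpa using h2, by simpa using h3, by simpa using h4⟩
    · rw [List.sublist_nil] at hr
      subst hr
      rw [List.pairwise_append] at h2
      exact Or.inr ⟨h3 a (by simp), s1, hs1, h2.1,
        fun x hx => ⟨h3 x (by simp [hx]), h2.2.2 x hx a (by simp)⟩, by simpa using h4⟩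
  · rintro (⟨s, h1, h2, h3, h4⟩ | ⟨ha, s, h1, h2, h3, h4⟩)
    · exact ⟨s, h1.trans (List.sublist_append_left _ _), h2, h3, h4⟩
    · refine ⟨s ++ [a], h1.append (List.Sublist.refl _), List.pairwise_append.2
        ⟨h2, by simp, fun x hx y hy => ?_⟩, ?_, by simp [h4]⟩
      · rw [List.mem_singleton.1 hy]
        exact (h3 x hx).2
      · intro x hx
        rcases List.mem_append.1 hx with hx | hx
        · exact (h3 x hx).1
        · rw [List.mem_singleton.1 hx]
          exact ha

open Classical in
theorem card_colInsert (a : A) (δ : Finset A) {I : A → Prop} (hI : Low I) (k : ℕ) :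
    k + 1 ≤ ((colInsert a δ).filter I).card ↔
      k + 1 ≤ (δ.filter I).card ∨ (I a ∧ k ≤ (δ.filter (fun x => I x ∧ x < a)).card) := by
  by_cases ha : I a
  · have hlt : δ.filter (fun x => I x ∧ x < a) = δ.filter (fun x => x < a) :=
      Finset.filter_congr fun x _ => ⟨fun h => h.2, fun h => ⟨hI _ _ h.le ha, h⟩⟩
    rw [hlt]
    have hsub : δ.filter (fun x => x < a) ⊆ δ.filter I := fun x hx => by
      rw [Finset.mem_filter] at hx ⊢
      exact ⟨hx.1, hI _ _ hx.2.le ha⟩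
    by_cases h : (δ.filter (fun y => a ≤ y)).Nonempty
    · rw [colInsert, dif_pos h]
      set y := (δ.filter (fun y => a ≤ y)).min' h with hy
      have hy1 : y ∈ δ.filter (fun y => a ≤ y) := Finset.min'_mem _ _
      rw [Finset.mem_filter] at hy1
      have hmin : ∀ z ∈ δ, a ≤ z → y ≤ z := fun z hz haz =>
        Finset.min'_le _ _ (by simp [hz, haz])
      have hane : a ∉ δ.erase y := fun hm => by
        rw [Finset.mem_erase] at hm
        exact hm.1 (le_antisymm hy1.2 (hmin a hm.2 le_rfl))
      rw [Finset.filter_insert, if_pos ha, Finset.card_insert_of_notMem (by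
        rw [Finset.mem_filter]; exact fun hm => hane hm.1)]
      by_cases hIy : I y
      · have e1 : (δ.erase y).filter I = (δ.filter I).erase y := by
          ext z; simp only [Finset.mem_filter, Finset.mem_erase]; tauto
        have hm : y ∈ δ.filter I := by simp [hy1.1, hIy]
        have hss : δ.filter (fun x => x < a) ⊆ (δ.filter I).erase y := fun x hx => by
          refine Finset.mem_erase.2 ⟨?_, hsub hx⟩
          rw [Finset.mem_filter] at hx
          exact (hx.2.trans_le hy1.2).ne
        have hc := Finset.card_le_card hss
        have hp := Finset.card_pos.2 ⟨y, hm⟩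
        rw [e1]
        rw [Finset.card_erase_of_mem hm] at hc ⊢
        simp only [ha, true_and]
        omega
      · have e1 : (δ.erase y).filter I = δ.filter (fun x => x < a) := by
          ext z
          simp only [Finset.mem_filter, Finset.mem_erase]
          constructor
          · rintro ⟨⟨_, h2⟩, h3⟩
            refine ⟨h2, lt_of_not_ge fun h4 => hIy (hI _ _ (hmin z h2 h4) h3)⟩
          · rintro ⟨h1, h2⟩
            exact ⟨⟨(h2.trans_le hy1.2).ne, h1⟩, hI _ _ h2.le ha⟩
        have e2 : δ.filter I = δ.filter (fun x => x < a) := by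
          rw [← e1]
          ext z
          simp only [Finset.mem_filter, Finset.mem_erase]
          constructor
          · rintro ⟨h1, h2⟩
            exact ⟨⟨fun h => hIy (h ▸ h2), h1⟩, h2⟩
          · rintro ⟨⟨_, h1⟩, h2⟩
            exact ⟨h1, h2⟩
        rw [e1, e2]
        simp only [ha, true_and]
        omega
    · rw [colInsert, dif_neg h]
      rw [Finset.not_nonempty_iff_eq_empty, Finset.filter_eq_empty_iff] at h
      have hane : a ∉ δ := fun hm => h hm le_rfl
      have e2 : δ.filter I = δ.filter (fun x => x < a) := by
        refine Finset.Subset.antisymm (fun x hx => ?_) hsub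
        rw [Finset.mem_filter] at hx ⊢
        exact ⟨hx.1, lt_of_not_ge (h hx.1)⟩
      rw [Finset.filter_insert, if_pos ha, Finset.card_insert_of_notMem (by
        rw [Finset.mem_filter]; exact fun hm => hane hm.1), e2]
      simp only [ha, true_and]
      omega
  · have e : (colInsert a δ).filter I = δ.filter I := by
      have hge : ∀ z, a ≤ z → ¬ I z := fun z hz hIz => ha (hI _ _ hz hIz)
      unfold colInsert
      split_ifs with h
      · have hy1 := Finset.min'_mem _ h
        rw [Finset.mem_filter] at hy1
        have hne := hge _ hy1.2
        ext z
        simp only [Finset.mem_filter, Finset.mem_insert, Finset.mem_erase]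
        constructor
        · rintro ⟨rfl | h1, h2⟩
          · exact absurd h2 ha
          · exact ⟨h1.2, h2⟩
        · rintro ⟨h1, h2⟩
          exact ⟨Or.inr ⟨fun h => hne (h ▸ h2), h1⟩, h2⟩
      · rw [Finset.filter_insert, if_neg ha]
    rw [e]
    simp [ha]

open Classical in
theorem Dec_iff_card (w : List A) {I : A → Prop} (hI : Low I) (k : ℕ) :
    Dec w I k ↔ k ≤ ((act w ∅).filter I).card := by
  induction w generalizing I k with
  | nil =>
    rw [act_nil]
    constructor
    · rintro ⟨s, h1, -, -, h4⟩
      rw [List.sublist_nil] at h1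
      subst h1
      simp at h4
      omega
    · intro h
      have : k = 0 := by simpa using h
      exact ⟨[], by simp, by simp, by simp, by simp [this]⟩
  | cons a w ih =>
    cases k with
    | zero => exact ⟨fun _ => Nat.zero_le _, fun _ => ⟨[], by simp, by simp, by simp, rfl⟩⟩
    | succ k =>
      have hI' : Low (fun x => I x ∧ x < a) := fun x y hxy h => ⟨hI x y hxy h.1, hxy.trans_lt h.2⟩
      rw [act_cons, card_colInsert a _ hI, Dec_cons, ih hI, ih hI']
      convert Iff.rfl

open Classical in
theorem Dec_append_sort (w : List A) (γ : Finset A) {I J : A → Prop} (hJ : Low J)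
    (hγ : ∀ x ∈ γ, J x) (hfull : ∀ x ∈ w, J x → x ∈ γ) (k : ℕ) :
    Dec (w ++ γ.sort (· ≥ ·)) I ((γ.filter I).card + k) ↔ Dec w (fun x => I x ∧ ¬ J x) k := by
  constructor
  · rintro ⟨s, h1, h2, h3, h4⟩
    obtain ⟨s1, s2, rfl, hs1, hs2⟩ := List.sublist_append_iff.1 h1
    have hs2J : ∀ x ∈ s2, J x := fun x hx => hγ x (by simpa using hs2.subset hx)
    have hlen : ((s1 ++ s2).filter (fun x => decide (J x))).length ≤ (γ.filter I).card := by
      have hnd : ((s1 ++ s2).filter (fun x => decide (J x))).Nodup :=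
        ((h2.imp (fun h => ne_of_gt h)).filter _)
      rw [← List.toFinset_card_of_nodup hnd]
      refine Finset.card_le_card fun x hx => ?_
      rw [List.mem_toFinset, List.mem_filter, decide_eq_true_iff] at hx
      rw [Finset.mem_filter]
      refine ⟨?_, h3 x hx.1⟩
      rcases List.mem_append.1 hx.1 with h | h
      · exact hfull x (hs1.subset h) hx.2
      · simpa using hs2.subset h
    have htot := List.length_eq_length_filter_add (l := s1 ++ s2) (fun x => decide (J x))
    have hnil : s2.filter (fun x => !decide (J x)) = [] := by
      rw [List.filter_eq_nil_iff]
      intro x hx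
      simp [hs2J x hx]
    have hD : Dec w (fun x => I x ∧ ¬ J x)
        ((s1 ++ s2).filter (fun x => !decide (J x))).length := by
      refine ⟨_, ?_, h2.filter _, ?_, rfl⟩
      · rw [List.filter_append, hnil, List.append_nil]
        exact List.filter_sublist.trans hs1
      · intro x hx
        rw [List.mem_filter] at hx
        exact ⟨h3 x hx.1, by simpa using hx.2⟩
    exact hD.mono (fun _ h => h) (by omega)
  · rintro ⟨s, h1, h2, h3, h4⟩
    refine ⟨s ++ (γ.sort (· ≥ ·)).filter (fun x => decide (I x)),
      h1.append List.filter_sublist, List.pairwise_append.2 ⟨h2, ?_, ?_⟩, ?_, ?_⟩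
    · exact (γ.sortedGT_sort).pairwise.filter _
    · intro x hx y hy
      rw [List.mem_filter, Finset.mem_sort] at hy
      exact lt_of_not_ge fun hxy => (h3 x hx).2 (hJ _ _ hxy (hγ y hy.1))
    · intro x hx
      rcases List.mem_append.1 hx with h | h
      · exact (h3 x h).1
      · simpa using (List.mem_filter.1 h).2
    · rw [List.length_append, h4, add_comm]
      congr 1
      rw [← List.toFinset_card_of_nodup ((Finset.sort_nodup _ _).filter _)]
      congr 1
      ext x
      simp

open Classical in
/-- Words with the same action have decreasing subwords of the same lengths, in any context and in
any interval of letters. -/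
theorem Dec_congr {u v : List A} (h : ∀ γ, act u γ = act v γ) (x y : List A) {I J : A → Prop}
    (hI : Low I) (hJ : Low J) (k : ℕ) :
    Dec (x ++ u ++ y) (fun z => I z ∧ ¬ J z) k ↔ Dec (x ++ v ++ y) (fun z => I z ∧ ¬ J z) k := by
  set γ : Finset A := ((x ++ u ++ y) ++ (x ++ v ++ y)).toFinset.filter J with hγ
  have hg : ∀ z ∈ γ, J z := fun z hz => (Finset.mem_filter.1 hz).2
  have h1 : ∀ z ∈ x ++ u ++ y, J z → z ∈ γ := fun z hz hz' =>
    Finset.mem_filter.2 ⟨List.mem_toFinset.2 (List.mem_append_left _ hz), hz'⟩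
  have h2 : ∀ z ∈ x ++ v ++ y, J z → z ∈ γ := fun z hz hz' =>
    Finset.mem_filter.2 ⟨List.mem_toFinset.2 (List.mem_append_right _ hz), hz'⟩
  rw [← Dec_append_sort _ γ hJ hg h1, ← Dec_append_sort _ γ hJ hg h2, Dec_iff_card _ hI,
    Dec_iff_card _ hI]
  simp only [act_append, h]

theorem act_sort (γ : Finset A) : act (γ.sort (· ≥ ·)) ∅ = γ := by
  have key : ∀ l : List A, l.Pairwise (· > ·) → act l ∅ = l.toFinset := by
    intro l
    induction l with
    | nil => intro _; rfl
    | cons a l ih =>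
      intro hl
      rw [List.pairwise_cons] at hl
      rw [act_cons, ih hl.2, colInsert, dif_neg, List.toFinset_cons]
      rw [Finset.not_nonempty_iff_eq_empty, Finset.filter_eq_empty_iff]
      intro x hx
      exact not_le_of_gt (hl.1 x (List.mem_toFinset.1 hx))
  rw [key _ γ.sortedGT_sort.pairwise, Finset.sort_toFinset]

open Classical in
theorem finset_eq_of_card {γ δ : Finset A}
    (h : ∀ I : A → Prop, Low I → (γ.filter I).card = (δ.filter I).card) : γ = δ := by
  have key : ∀ (ε : Finset A) (c : A), c ∈ ε ↔
      (ε.filter (fun x => x < c)).card < (ε.filter (fun x => x ≤ c)).card := by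
    intro ε c
    constructor
    · intro hc
      refine Finset.card_lt_card ⟨fun x hx => ?_, fun hs => ?_⟩
      · rw [Finset.mem_filter] at hx ⊢
        exact ⟨hx.1, hx.2.le⟩
      · have := hs (Finset.mem_filter.2 ⟨hc, le_rfl⟩)
        simp at this
    · intro hlt
      by_contra hc
      refine hlt.ne (congrArg _ (Finset.filter_congr fun x hx => ⟨le_of_lt, fun hle => ?_⟩))
      exact lt_of_le_of_ne hle fun he => hc (he ▸ hx)
  ext c
  have h1 : (γ.filter (fun x => x < c)).card = (δ.filter (fun x => x < c)).card := by
    convert h (fun x => x < c) fun x y hxy hy => hxy.trans_lt hy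
  have h2 : (γ.filter (fun x => x ≤ c)).card = (δ.filter (fun x => x ≤ c)).card := by
    convert h (fun x => x ≤ c) fun x y hxy hy => hxy.trans hy
  rw [key γ, key δ, h1, h2]

/-- There are letters `z₁ < ⋯ < zₖ` in `I` and not in `J`, one in each of the first `k` rows. -/
def Chain : List (Finset A) → (A → Prop) → (A → Prop) → ℕ → Prop
  | _, _, _, 0 => True
  | [], _, _, _ + 1 => False
  | R :: T, J, I, k + 1 => ∃ z ∈ R, I z ∧ ¬ J z ∧ Chain T (fun x => x ≤ z) I k

theorem Chain.zero (T : List (Finset A)) (J I : A → Prop) : Chain T J I 0 := by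
  cases T <;> trivial

/-- Each row is non-empty, contains the rows above and, for each letter above, a smaller one. -/
def Good : List (Finset A) → Prop
  | [] => True
  | R :: T => R.Nonempty ∧ (∀ S ∈ T, ∀ x ∈ S, x ∈ R ∧ ∃ z ∈ R, z < x) ∧ Good T

theorem Chain.anti {T : List (Finset A)} {J J' I : A → Prop} {k : ℕ} (h : Chain T J I k)
    (hJ : ∀ S ∈ T, ∀ x ∈ S, J' x → J x) : Chain T J' I k := by
  cases k with
  | zero => exact Chain.zero _ _ _
  | succ k =>
    cases T with
    | nil => exact h
    | cons R T =>
      obtain ⟨z, h1, h2, h3, h4⟩ := h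
      exact ⟨z, h1, h2, fun hz => h3 (hJ R (by simp) z h1 hz), h4⟩

theorem Chain.down {R : Finset A} {T : List (Finset A)} (hg : Good (R :: T)) {J I : A → Prop}
    {k : ℕ} (h : Chain T J I k) : Chain (R :: T) J I k := by
  induction T generalizing R J k with
  | nil =>
    cases k with
    | zero => exact Chain.zero _ _ _
    | succ k => exact h.elim
  | cons R' T ih =>
    cases k with
    | zero => exact Chain.zero _ _ _
    | succ k =>
      obtain ⟨z, h1, h2, h3, h4⟩ := h
      exact ⟨z, (hg.2.1 R' (by simp) z h1).1, h2, h3, ih hg.2.2 h4⟩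

theorem mem_nInsert {T : List (Finset A)} {a x : A} {S : Finset A} (hS : S ∈ nInsert T a)
    (hx : x ∈ S) : x = a ∨ ∃ S' ∈ T, x ∈ S' := by
  induction T generalizing a with
  | nil =>
    simp only [nInsert, List.mem_singleton] at hS
    subst hS
    exact Or.inl (Finset.mem_singleton.1 hx)
  | cons R T ih =>
    rw [nInsert, List.mem_cons] at hS
    rcases hS with rfl | hS
    · rcases Finset.mem_insert.1 hx with h | h
      · exact Or.inl h
      · exact Or.inr ⟨R, by simp, h⟩
    · split_ifs at hS with h
      · rcases ih hS with h' | ⟨S', h1, h2⟩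
        · have := Finset.min'_mem _ h
          rw [← h', Finset.mem_filter] at this
          exact Or.inr ⟨R, by simp, this.1⟩
        · exact Or.inr ⟨S', by simp [h1], h2⟩
      · exact Or.inr ⟨S, by simp [hS], hx⟩

theorem Good.nInsert {T : List (Finset A)} (hT : Good T) (a : A) : Good (nInsert T a) := by
  induction T generalizing a with
  | nil => exact ⟨Finset.singleton_nonempty a, by simp, trivial⟩
  | cons R T ih =>
    rw [Stylic.nInsert]
    refine ⟨Finset.insert_nonempty _ _, ?_, ?_⟩
    · intro S hS x hx
      have old : ∀ S' ∈ T, x ∈ S' → x ∈ insert a R ∧ ∃ z ∈ insert a R, z < x := by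
        intro S' hS' hx'
        obtain ⟨h1, z, h2, h3⟩ := hT.2.1 S' hS' x hx'
        exact ⟨Finset.mem_insert_of_mem h1, z, Finset.mem_insert_of_mem h2, h3⟩
      split_ifs at hS with h
      · rcases mem_nInsert hS hx with h' | ⟨S', h1, h2⟩
        · have := Finset.min'_mem _ h
          rw [← h', Finset.mem_filter] at this
          exact ⟨Finset.mem_insert_of_mem this.1, a, Finset.mem_insert_self _ _, this.2⟩
        · exact old S' h1 h2
      · exact old S hS hx
    · split_ifs with h
      · exact ih hT.2.2 _
      · exact hT.2.2

theorem Chain_nInsert {T : List (Finset A)} (hT : Good T) (a : A) {I J : A → Prop} (hI : Low I)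
    (hJ : Low J) (k : ℕ) : Chain (nInsert T a) J I (k + 1) ↔
      Chain T J I (k + 1) ∨ (I a ∧ ¬ J a ∧ Chain T (fun x => x ≤ a) I k) := by
  induction T generalizing a J k with
  | nil =>
    rw [nInsert]
    cases k with
    | zero => simp [Chain]
    | succ k => simp [Chain]
  | cons R T ih =>
    have low : ∀ z : A, Low (fun x => x ≤ z) := fun z x y hxy hy => hxy.trans hy
    rw [nInsert]
    split_ifs with h
    · set y := (R.filter (fun y => a < y)).min' h with hy
      have hy1 : y ∈ R.filter (fun y => a < y) := Finset.min'_mem _ _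
      rw [Finset.mem_filter] at hy1
      have hmin : ∀ z ∈ R, a < z → y ≤ z := fun z hz haz =>
        Finset.min'_le _ _ (by simp [hz, haz])
      constructor
      · rintro ⟨z, h1, h2, h3, h4⟩
        cases k with
        | zero =>
          rcases Finset.mem_insert.1 h1 with rfl | h1
          · exact Or.inr ⟨h2, h3, Chain.zero _ _ _⟩
          · exact Or.inl ⟨z, h1, h2, h3, Chain.zero _ _ _⟩
        | succ j =>
          rw [ih hT.2.2 y (low z)] at h4
          rcases Finset.mem_insert.1 h1 with rfl | h1
          · refine Or.inr ⟨h2, h3, ?_⟩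
            rcases h4 with h4 | ⟨h5, h6, h7⟩
            · exact h4.down hT
            · exact ⟨y, hy1.1, h5, h6, h7⟩
          · rcases h4 with h4 | ⟨h5, h6, h7⟩
            · exact Or.inl ⟨z, h1, h2, h3, h4⟩
            · have hza : z ≤ a := le_of_not_gt fun hlt => h6 (hmin z h1 hlt)
              exact Or.inr ⟨hI _ _ hy1.2.le h5, fun hJa => h3 (hJ _ _ hza hJa), y, hy1.1, h5,
                not_le_of_gt hy1.2, h7⟩
      · rintro (⟨z, h1, h2, h3, h4⟩ | ⟨h2, h3, h4⟩)
        · refine ⟨z, Finset.mem_insert_of_mem h1, h2, h3, ?_⟩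
          cases k with
          | zero => exact Chain.zero _ _ _
          | succ j => exact (ih hT.2.2 y (low z) j).2 (Or.inl h4)
        · refine ⟨a, Finset.mem_insert_self _ _, h2, h3, ?_⟩
          cases k with
          | zero => exact Chain.zero _ _ _
          | succ j =>
            obtain ⟨z, g1, g2, g3, g4⟩ := h4
            have hyz := hmin z g1 (lt_of_not_ge g3)
            exact (ih hT.2.2 y (low a) j).2 (Or.inr ⟨hI _ _ hyz g2, not_le_of_gt hy1.2,
              g4.anti fun _ _ x _ hx => le_trans hx hyz⟩)
    · rw [Finset.not_nonempty_iff_eq_empty, Finset.filter_eq_empty_iff] at h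
      constructor
      · rintro ⟨z, h1, h2, h3, h4⟩
        rcases Finset.mem_insert.1 h1 with rfl | h1
        · exact Or.inr ⟨h2, h3, h4.down hT⟩
        · exact Or.inl ⟨z, h1, h2, h3, h4⟩
      · rintro (⟨z, h1, h2, h3, h4⟩ | ⟨h2, h3, h4⟩)
        · exact ⟨z, Finset.mem_insert_of_mem h1, h2, h3, h4⟩
        · cases k with
          | zero => exact ⟨a, Finset.mem_insert_self _ _, h2, h3, Chain.zero _ _ _⟩
          | succ j =>
            obtain ⟨z, g1, g2, g3, g4⟩ := h4
            exact absurd (lt_of_not_ge g3) (h g1)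

theorem nTableau_concat (w : List A) (a : A) : nTableau (w ++ [a]) = nInsert (nTableau w) a := by
  simp [nTableau]

theorem good_nTableau (w : List A) : Good (nTableau w) := by
  induction w using List.reverseRecOn with
  | nil => trivial
  | append_singleton w a ih =>
    rw [nTableau_concat]
    exact ih.nInsert a

theorem Dec_iff_Chain (w : List A) {I J : A → Prop} (hI : Low I) (hJ : Low J) (k : ℕ) :
    Dec w (fun x => I x ∧ ¬ J x) k ↔ Chain (nTableau w) J I k := by
  induction w using List.reverseRecOn generalizing J k with
  | nil =>
    cases k with
    | zero => exact ⟨fun _ => Chain.zero _ _ _, fun _ => ⟨[], by simp, by simp, by simp, rfl⟩⟩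
    | succ k =>
      refine ⟨?_, fun h => h.elim⟩
      rintro ⟨s, h1, -, -, h4⟩
      rw [List.sublist_nil] at h1
      subst h1
      simp at h4
  | append_singleton w a ih =>
    cases k with
    | zero => exact ⟨fun _ => Chain.zero _ _ _, fun _ => ⟨[], by simp, by simp, by simp, rfl⟩⟩
    | succ k =>
      rw [nTableau_concat, Chain_nInsert (good_nTableau w) a hI hJ, Dec_concat, ih hJ,
        ← ih (J := fun x => x ≤ a) fun x y hxy hy => hxy.trans hy, and_assoc]
      refine or_congr Iff.rfl (and_congr_right fun ha => and_congr_right fun hJa => ?_)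
      constructor <;> intro h <;> refine h.mono (fun x hx => ?_) le_rfl
      · exact ⟨hx.1.1, not_le_of_gt hx.2⟩
      · exact ⟨⟨hx.1, fun hx' => hJa (hJ _ _ (lt_of_not_ge hx.2).le hx')⟩, lt_of_not_ge hx.2⟩

theorem eq_of_Chain {T T' : List (Finset A)} (hT : Good T) (hT' : Good T')
    (h : ∀ I J : A → Prop, Low I → Low J → ∀ k, Chain T J I k ↔ Chain T' J I k) : T = T' := by
  have one : ∀ (R : Finset A) (T : List (Finset A)) (c : A),
      Chain (R :: T) (fun x => x < c) (fun x => x ≤ c) 1 ↔ c ∈ R := by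
    intro R T c
    constructor
    · rintro ⟨z, h1, h2, h3, -⟩
      rwa [le_antisymm h2 (le_of_not_gt h3)] at h1
    · intro hc
      exact ⟨c, hc, le_rfl, lt_irrefl c, Chain.zero _ _ _⟩
  have lowlt : ∀ z : A, Low (fun x => x < z) := fun z x y hxy hy => hxy.trans_lt hy
  have lowle : ∀ z : A, Low (fun x => x ≤ z) := fun z x y hxy hy => hxy.trans hy
  induction T generalizing T' with
  | nil =>
    cases T' with
    | nil => rfl
    | cons R T' =>
      obtain ⟨c, hc⟩ := hT'.1
      exact ((h _ _ (lowle c) (lowlt c) 1).2 ((one R T' c).2 hc)).elim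
  | cons R T ih =>
    cases T' with
    | nil =>
      obtain ⟨c, hc⟩ := hT.1
      exact ((h _ _ (lowle c) (lowlt c) 1).1 ((one R T c).2 hc)).elim
    | cons R' T' =>
      have hR : R = R' := by
        ext c
        rw [← one R T c, ← one R' T' c]
        exact h _ _ (lowle c) (lowlt c) 1
      subst hR
      congr 1
      refine ih hT.2.2 hT'.2.2 fun I J hI hJ k => ?_
      cases k with
      | zero => exact ⟨fun _ => Chain.zero _ _ _, fun _ => Chain.zero _ _ _⟩
      | succ k =>
        -- `z`: the largest letter of the bottom row in `J`, or the smallest letter if none is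
        obtain ⟨z, hz, hz1, hz2⟩ : ∃ z ∈ R, (∀ x ∈ R, (∃ y ∈ R, y < x) → J x → x ≤ z) ∧
            (∀ x ∈ R, (∃ y ∈ R, y < x) → x ≤ z → J x) := by
          classical
          by_cases hne : (R.filter J).Nonempty
          · have hm := Finset.max'_mem _ hne
            rw [Finset.mem_filter] at hm
            exact ⟨_, hm.1, fun x hx _ hJx => Finset.le_max' _ _ (by simp [hx, hJx]),
              fun x _ _ hxz => hJ _ _ hxz hm.2⟩
          · rw [Finset.not_nonempty_iff_eq_empty, Finset.filter_eq_empty_iff] at hne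
            refine ⟨_, Finset.min'_mem R hT.1, fun x hx _ hJx => absurd hJx (hne hx), ?_⟩
            rintro x _ ⟨y, hy, hyx⟩ hxz
            exact absurd (Finset.min'_le _ _ hy) (not_le_of_gt (hyx.trans_le hxz))
        have key : ∀ U : List (Finset A), Good (R :: U) →
            (Chain U J I (k + 1) ↔ Chain (R :: U) (fun x => x < z) I (k + 2)) := by
          intro U hU
          constructor
          · intro hc
            have hc' : Chain U (fun x => x ≤ z) I (k + 1) := hc.anti fun S hS x hx hxz =>
              hz2 x (hU.2.1 S hS x hx).1 (hU.2.1 S hS x hx).2 hxz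
            refine ⟨z, hz, ?_, lt_irrefl z, hc'⟩
            cases U with
            | nil => exact hc'.elim
            | cons S U =>
              obtain ⟨y, _, g2, g3, _⟩ := hc'
              exact hI _ _ (lt_of_not_ge g3).le g2
          · rintro ⟨y, _, _, g3, g4⟩
            exact g4.anti fun S hS x hx hJx =>
              (hz1 x (hU.2.1 S hS x hx).1 (hU.2.1 S hS x hx).2 hJx).trans (le_of_not_gt g3)
        rw [key T hT, key T' hT']
        exact h _ _ hI (lowlt z) _

/-- The `N`-tableau of a word depends only on its class in the stylic monoid. -/
theorem nTableau_congr {u v : List A} (h : mu u = mu v) : nTableau u = nTableau v := by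
  refine eq_of_Chain (good_nTableau u) (good_nTableau v) fun I J hI hJ k => ?_
  rw [← Dec_iff_Chain u hI hJ, ← Dec_iff_Chain v hI hJ]
  simpa using Dec_congr (mu_eq_iff.1 h) [] [] hI hJ k

end WellDefined

section WellDefinedTheta

variable {A : Type*} [Fintype A] [LinearOrder A]

theorem wordTheta_append (u v : List A) : wordTheta (u ++ v) = wordTheta v ++ wordTheta u := by
  simp [wordTheta]

theorem wordTheta_wordTheta (w : List A) : wordTheta (wordTheta w) = w := by
  rw [wordTheta, wordTheta, List.map_reverse, List.reverse_reverse, List.map_map]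
  conv_rhs => rw [← List.map_id w]
  exact List.map_congr_left fun a _ => letterRev_letterRev a

theorem Dec.theta {w : List A} {p : A → Prop} {k : ℕ} (h : Dec w p k) :
    Dec (wordTheta w) (fun x => p (letterRev x)) k := by
  obtain ⟨s, h1, h2, h3, h4⟩ := h
  refine ⟨wordTheta s, (h1.map _).reverse, ?_, ?_, by simp [wordTheta, h4]⟩
  · rw [wordTheta, List.pairwise_reverse, List.pairwise_map]
    exact h2.imp fun h => letterRev_lt.2 h
  · intro x hx
    simp only [wordTheta, List.mem_reverse, List.mem_map] at hx
    obtain ⟨y, hy, rfl⟩ := hx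
    rw [letterRev_letterRev]
    exact h3 y hy

/-- The anti-automorphism `θ` of the free monoid preserves the stylic congruence. -/
theorem mu_wordTheta_congr {u v : List A} (h : mu u = mu v) :
    mu (wordTheta u) = mu (wordTheta v) := by
  classical
  rw [mu_eq_iff] at h
  have key : ∀ (u v g : List A), (∀ γ, act u γ = act v γ) → ∀ (I : A → Prop), Low I → ∀ k,
      Dec (wordTheta u ++ g) I k → Dec (wordTheta v ++ g) I k := by
    intro u v g huv I hI k hD
    have hJ : Low (fun x : A => ¬ I (letterRev x)) := fun x y hxy hy hx => by
      refine hy (hI _ _ ?_ hx)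
      exact le_of_not_gt fun hlt => not_lt_of_ge hxy (letterRev_lt.1 hlt)
    have hD' := hD.theta
    rw [wordTheta_append, wordTheta_wordTheta] at hD'
    have := (Dec_congr huv (wordTheta g) [] (I := fun _ => True) (fun _ _ _ _ => trivial) hJ k).1
      (by rw [List.append_nil]; exact hD'.mono (fun x hx => ⟨trivial, not_not.2 hx⟩) le_rfl)
    rw [List.append_nil] at this
    have := this.theta
    rw [wordTheta_append, wordTheta_wordTheta] at this
    refine this.mono (fun x hx => ?_) le_rfl
    have := not_not.1 hx.2
    rwa [letterRev_letterRev] at this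
  rw [mu_eq_iff]
  intro γ
  refine finset_eq_of_card fun I hI => ?_
  have hc : ∀ w : List A, act (wordTheta w) γ = act (wordTheta w ++ γ.sort (· ≥ ·)) ∅ := by
    intro w
    rw [act_append, act_sort]
  rw [hc u, hc v]
  refine le_antisymm ?_ ?_
  · exact (Dec_iff_card _ hI _).1 (key u v _ h I hI _ ((Dec_iff_card _ hI _).2 le_rfl))
  · exact (Dec_iff_card _ hI _).1
      (key v u _ (fun γ => (h γ).symm) I hI _ ((Dec_iff_card _ hI _).2 le_rfl))

end WellDefinedTheta

/-! ### `N`, `θ`, `η` and `w` on the stylic monoid -/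

noncomputable section

variable {A : Type*} [LinearOrder A]

/-- The `N`-tableau `N(x)` of an element of the stylic monoid. -/
def stylN (x : Styl A) : List (Finset A) := nTableau (mu_surjective x).choose

theorem stylN_mu (w : List A) : stylN (mu w) = nTableau w :=
  nTableau_congr (mu_surjective (mu w)).choose_spec

/-- `η(x)`: the first column of `N(x)`. -/
def eta (x : Styl A) : Finset A := firstColumn (stylN x)

/-- `w_x`: the word such that `η(x) w_x` is the column-reading word of `N(x)`. -/
def wWord (x : Styl A) : List A := restReading (stylN x)

variable [Fintype A]

/-- The anti-automorphism `θ` of the stylic monoid. -/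
def stylTheta (x : Styl A) : Styl A := mu (wordTheta (mu_surjective x).choose)

theorem stylTheta_mu (w : List A) : stylTheta (mu w) = mu (wordTheta w) :=
  mu_wordTheta_congr (mu_surjective (mu w)).choose_spec

/-! ### The stylic algebra -/

variable (K : Type*) [Field K]

/-- The image of a word in the stylic algebra `K Styl(A)`. -/
def ofWord (w : List A) : MonoidAlgebra K (Styl A) := MonoidAlgebra.of K (Styl A) (mu w)

/-- `e_γ`: the product of the `1 - a`, `a ∉ γ`, in increasing order of the letters, times the
product of the `a ∈ γ` in decreasing order. -/
def e (γ : Finset A) : MonoidAlgebra K (Styl A) :=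
  ((γᶜ.sort (· ≤ ·)).map fun a => 1 - ofWord K [a]).prod *
    ((γ.sort (· ≥ ·)).map fun a => ofWord K [a]).prod

/-- The element `e_{η(x)} w_x` of the stylic algebra. -/
def basisElt (x : Styl A) : MonoidAlgebra K (Styl A) := e K (eta x) * ofWord K (wWord x)

/-- The right module `e_γ K Styl(A)`. -/
def rightModule (γ : Finset A) :
    Submodule (MonoidAlgebra K (Styl A))ᵐᵒᵖ (MonoidAlgebra K (Styl A)) :=
  Submodule.span _ {e K γ}

/-- The left module `K Styl(A) e_γ`. -/
def leftModule (γ : Finset A) :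
    Submodule (MonoidAlgebra K (Styl A)) (MonoidAlgebra K (Styl A)) :=
  Submodule.span _ {e K γ}

theorem mem_rightModule {γ : Finset A} {x : MonoidAlgebra K (Styl A)} :
    x ∈ rightModule K γ ↔ ∃ y, e K γ * y = x := by
  rw [rightModule, Submodule.mem_span_singleton]
  exact ⟨fun ⟨y, hy⟩ => ⟨y.unop, hy⟩, fun ⟨y, hy⟩ => ⟨MulOpposite.op y, hy⟩⟩

theorem mem_leftModule {γ : Finset A} {x : MonoidAlgebra K (Styl A)} :
    x ∈ leftModule K γ ↔ ∃ y, y * e K γ = x := by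
  rw [leftModule, Submodule.mem_span_singleton]
  rfl

end

end Stylic

namespace Stylic

/-! ### Column insertion and decreasing words -/

section Columns

variable {A : Type*} [LinearOrder A]

/-! Write `P_γ` for the increasing product of the `1 - a`, `a ∉ γ`, so that `e_γ = P_γ γ`, where `γ`
is read as a decreasing word. The column-reading word of `N(x)` represents `x`
(`mu_eta_append_wWord`), hence `e_{η(x)} w_x = P_{η(x)} x` (`basisElt_eq`).

Two facts govern left multiplication. A letter `a ∈ η(x)` satisfies `a x = x`, and inserting letters
larger than `a` never removes `a` from a column. So in `P_γ x` with some `a ∈ η(x) \ γ`, the factors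
to the right of `1 - a` keep `a` in the first column and `1 - a` then kills everything: `P_γ x = 0`
unless `η(x) ⊆ γ`. If instead all letters of the product lie outside `η(x)`, it sends `x` to `x`
plus terms of larger `potential`. By triangularity the elements `P_{η(x)} x` span the algebra, and a
dimension count makes them a basis.

Right module: `e_γ w = P_γ (γ w)`, and `η(γ w)` has at least `|γ|` letters. Hence either `e_γ w =
0`, or `η(γ w) = γ` and `e_γ w` is the basis element of `γ w`.

Left module: right multiplication by `e_γ` fixes the basis element of `x` if `θ(η(θ(x))) = γ` and
kills it otherwise (`basisElt_mul_e_self`, `basisElt_mul_e_of_ne`), so its image is spanned by the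
fixed ones. The link between the two sides is that `η(x)` and `θ(η(θ(x)))` both have as cardinality
the length of the longest decreasing subword; when right multiplication makes this length grow,
`P_{η(x)}` kills the result. -/

theorem mem_colInsert_self (a : A) (δ : Finset A) : a ∈ colInsert a δ := by
  unfold colInsert
  split_ifs <;> exact Finset.mem_insert_self _ _

theorem mem_colInsert_of_lt {a b : A} {δ : Finset A} (hb : b ∈ δ) (hba : b < a) :
    b ∈ colInsert a δ := by
  unfold colInsert
  split_ifs with h
  · have hm := Finset.min'_mem _ h
    rw [Finset.mem_filter] at hm
    exact Finset.mem_insert_of_mem (Finset.mem_erase.2 ⟨(hba.trans_le hm.2).ne, hb⟩)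
  · exact Finset.mem_insert_of_mem hb

theorem colInsert_of_mem {a : A} {δ : Finset A} (ha : a ∈ δ) : colInsert a δ = δ := by
  have h : (δ.filter (fun y => a ≤ y)).Nonempty := ⟨a, by simp [ha]⟩
  have hmin : (δ.filter (fun y => a ≤ y)).min' h = a := by
    refine le_antisymm (Finset.min'_le _ _ (by simp [ha])) ?_
    exact (Finset.mem_filter.1 (Finset.min'_mem _ h)).2
  rw [colInsert, dif_pos h, hmin, Finset.insert_erase ha]

/-- A decreasing word acts by producing columns that contain its letters. -/
theorem mem_act_of_pairwise {l : List A} (hl : l.Pairwise (· > ·)) {a : A} (ha : a ∈ l)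
    (δ : Finset A) : a ∈ act l δ := by
  induction l with
  | nil => simp at ha
  | cons b l ih =>
    rw [List.pairwise_cons] at hl
    rw [act_cons]
    rcases List.mem_cons.1 ha with rfl | ha
    · exact mem_colInsert_self _ _
    · exact mem_colInsert_of_lt (ih hl.2 ha) (hl.1 a ha)

/-! ### Decreasing subwords of a concatenation. -/

theorem Dec.sublist {u v : List A} {p : A → Prop} {k : ℕ} (h : Dec u p k) (huv : u.Sublist v) :
    Dec v p k := by
  obtain ⟨s, h1, h⟩ := h
  exact ⟨s, h1.trans huv, h⟩

theorem Dec.imp {w : List A} {p q : A → Prop} {k : ℕ} (h : Dec w p k)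
    (hpq : ∀ x ∈ w, p x → q x) : Dec w q k := by
  obtain ⟨s, h1, h2, h3, h4⟩ := h
  exact ⟨s, h1, h2, fun x hx => hpq x (h1.subset hx) (h3 x hx), h4⟩

/-- The part in `u` lies above the cut `L` and the part in `v` below it, so their concatenation is
still decreasing. `Dec.exists_of_append` is the converse. -/
theorem Dec.append {u v : List A} {p L : A → Prop} (hL : Low L) {i j : ℕ}
    (hu : Dec u (fun x => p x ∧ ¬ L x) i) (hv : Dec v (fun x => p x ∧ L x) j) :
    Dec (u ++ v) p (i + j) := by
  obtain ⟨s, h1, h2, h3, h4⟩ := hu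
  obtain ⟨t, g1, g2, g3, g4⟩ := hv
  refine ⟨s ++ t, h1.append g1, List.pairwise_append.2 ⟨h2, g2, fun x hx y hy => ?_⟩, ?_,
    by simp [h4, g4]⟩
  · exact lt_of_not_ge fun hxy => (h3 x hx).2 (hL _ _ hxy (g3 y hy).2)
  · intro x hx
    rcases List.mem_append.1 hx with hx | hx
    · exact (h3 x hx).1
    · exact (g3 x hx).1

theorem Dec.exists_of_append {u v : List A} {p : A → Prop} {k : ℕ} (h : Dec (u ++ v) p k) :
    ∃ L : A → Prop, Low L ∧ ∃ i j, i + j = k ∧ Dec u (fun x => p x ∧ ¬ L x) i ∧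
      Dec v (fun x => p x ∧ L x) j := by
  obtain ⟨s, h1, h2, h3, h4⟩ := h
  obtain ⟨s1, s2, rfl, hs1, hs2⟩ := List.sublist_append_iff.1 h1
  rw [List.pairwise_append] at h2
  -- The cut is the down-closure of the letters taken from `v`; all letters taken from `u` exceed
  -- them.
  refine ⟨fun x => ∃ y ∈ s2, x ≤ y, fun x y hxy ⟨z, hz, hyz⟩ => ⟨z, hz, hxy.trans hyz⟩,
    s1.length, s2.length, by simpa using h4, ⟨s1, hs1, h2.1, fun x hx => ⟨h3 x (by simp [hx]), ?_⟩,
    rfl⟩, ⟨s2, hs2, h2.2.1, fun x hx => ⟨h3 x (by simp [hx]), x, hx, le_rfl⟩, rfl⟩⟩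
  rintro ⟨y, hy, hxy⟩
  exact absurd (h2.2.2 x hx y hy) (not_lt_of_ge hxy)

theorem Low.true : Low (fun _ : A => True) := fun _ _ _ _ => trivial

theorem Low.false : Low (fun _ : A => False) := fun _ _ _ h => h

-- By `Dec_iff_card`, these lengths count the letters of `w · ∅` in each lower set, and such counts
-- determine a column.
open Classical in
theorem act_empty_eq_of_Dec {u v : List A}
    (h : ∀ I : A → Prop, Low I → ∀ k, Dec u I k ↔ Dec v I k) : act u ∅ = act v ∅ := by
  refine finset_eq_of_card fun I hI => le_antisymm ?_ ?_
  · exact (Dec_iff_card v hI _).1 ((h I hI _).1 ((Dec_iff_card u hI _).2 le_rfl))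
  · exact (Dec_iff_card u hI _).1 ((h I hI _).2 ((Dec_iff_card v hI _).2 le_rfl))

/-- Words with the same lengths of decreasing subwords in all intervals are congruent. -/
theorem mu_eq_of_Dec {u v : List A}
    (h : ∀ I J : A → Prop, Low I → Low J → ∀ k,
      Dec u (fun x => I x ∧ ¬ J x) k ↔ Dec v (fun x => I x ∧ ¬ J x) k) : mu u = mu v := by
  rw [mu_eq_iff]
  intro γ
  -- `w · γ` is the action on `∅` of `w` followed by the reading of `γ`. A decreasing subword of
  -- that word is cut into a part in `w` above some `L` and a part in `γ` below it, and only the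
  -- former depends on `w`.
  have key : ∀ u v : List A, (∀ I J : A → Prop, Low I → Low J → ∀ k,
      Dec u (fun x => I x ∧ ¬ J x) k → Dec v (fun x => I x ∧ ¬ J x) k) → ∀ I : A → Prop, Low I →
      ∀ k, Dec (u ++ γ.sort (· ≥ ·)) I k → Dec (v ++ γ.sort (· ≥ ·)) I k := by
    intro u v huv I hI k hD
    obtain ⟨L, hL, i, j, rfl, h1, h2⟩ := hD.exists_of_append
    exact Dec.append hL (huv I L hI hL i h1) h2
  have hγ : ∀ w, act w γ = act (w ++ γ.sort (· ≥ ·)) ∅ := fun w => by rw [act_append, act_sort]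
  rw [hγ, hγ]
  exact act_empty_eq_of_Dec fun I hI k =>
    ⟨key u v (fun I J hI hJ k => (h I J hI hJ k).1) I hI k,
      key v u (fun I J hI hJ k => (h I J hI hJ k).2) I hI k⟩

end Columns

/-! ### Column reading of a tableau -/

section Reading

variable {A : Type*} [LinearOrder A]

/-- Each row contains the rows above and, for each letter above, a smaller one. -/
def Nested : List (Finset A) → Prop
  | [] => True
  | R :: T => (∀ S ∈ T, ∀ x ∈ S, x ∈ R ∧ ∃ z ∈ R, z < x) ∧ Nested T

theorem Good.nested {T : List (Finset A)} (h : Good T) : Nested T := by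
  induction T with
  | nil => trivial
  | cons R T ih => exact ⟨h.2.1, ih h.2.2⟩

theorem Nested.chain_cons {R : Finset A} {T : List (Finset A)} (hg : Nested (R :: T))
    {J I : A → Prop} {k : ℕ} (h : Chain T J I k) : Chain (R :: T) J I k := by
  induction T generalizing R J k with
  | nil =>
    cases k with
    | zero => exact Chain.zero _ _ _
    | succ k => exact h.elim
  | cons R' T ih =>
    cases k with
    | zero => exact Chain.zero _ _ _
    | succ k =>
      obtain ⟨z, h1, h2, h3, h4⟩ := h
      exact ⟨z, (hg.1 R' (by simp) z h1).1, h2, h3, ih hg.2 h4⟩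

/-- A row without its smallest letter. -/
def tailRow (R : Finset A) : Finset A := (R.sort (· ≤ ·)).tail.toFinset

theorem sort_tailRow (R : Finset A) : (tailRow R).sort (· ≤ ·) = (R.sort (· ≤ ·)).tail :=
  (List.toFinset_sort (· ≤ ·) (R.sort_nodup (· ≤ ·)).tail).2 (R.pairwise_sort (· ≤ ·)).tail

theorem tabColumn_map_tailRow (T : List (Finset A)) (j : ℕ) :
    tabColumn (T.map tailRow) j = tabColumn T (j + 1) := by
  simp [tabColumn, List.filterMap_map, sort_tailRow]

theorem mem_of_mem_tabColumn {T : List (Finset A)} {j : ℕ} {x : A} (hx : x ∈ tabColumn T j) :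
    ∃ S ∈ T, x ∈ S := by
  rw [tabColumn, List.mem_filterMap] at hx
  obtain ⟨S, hS, hx⟩ := hx
  exact ⟨S, hS, (Finset.mem_sort (· ≤ ·)).1 (List.mem_of_getElem? hx)⟩

/-- A row is empty or splits into its smallest letter and the remaining ones. -/
theorem row_cases (R : Finset A) : R = ∅ ∨ ∃ m ∈ R, (∀ x ∈ R, m ≤ x) ∧
    (∀ x, x ∈ tailRow R ↔ x ∈ R ∧ m < x) ∧ (R.sort (· ≤ ·))[0]? = some m := by
  rcases h : R.sort (· ≤ ·) with _ | ⟨m, l⟩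
  · refine Or.inl (Finset.eq_empty_of_forall_notMem fun x hx => ?_)
    rw [← Finset.mem_sort (· ≤ ·), h] at hx
    simp at hx
  · have hmem : ∀ x, x ∈ R ↔ x = m ∨ x ∈ l := fun x => by
      rw [← Finset.mem_sort (· ≤ ·), h, List.mem_cons]
    have hp := (R.sortedLT_sort).pairwise
    rw [h, List.pairwise_cons] at hp
    refine Or.inr ⟨m, (hmem m).2 (Or.inl rfl), fun x hx => ?_, fun x => ?_, by simp⟩
    · rcases (hmem x).1 hx with rfl | hx
      · exact le_rfl
      · exact (hp.1 x hx).le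
    · rw [tailRow, h, List.tail_cons, List.mem_toFinset, hmem]
      constructor
      · exact fun hx => ⟨Or.inr hx, hp.1 x hx⟩
      · rintro ⟨rfl | hx, hlt⟩
        · exact absurd hlt (lt_irrefl _)
        · exact hx

theorem mem_of_mem_tailRow {R : Finset A} {x : A} (hx : x ∈ tailRow R) : x ∈ R := by
  rw [tailRow, List.mem_toFinset] at hx
  exact (Finset.mem_sort (· ≤ ·)).1 (List.mem_of_mem_tail hx)

/-- The smallest letter of an upper row has a smaller letter in each row below it, so it survives
there and witnesses the condition. Rows may become empty, which is why `Nested`, unlike `Good`, does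
not ask for non-empty rows. -/
theorem Nested.map_tailRow {T : List (Finset A)} (hT : Nested T) : Nested (T.map tailRow) := by
  induction T with
  | nil => trivial
  | cons R T ih =>
    refine ⟨fun S' hS' x hx => ?_, ih hT.2⟩
    obtain ⟨S, hS, rfl⟩ := List.mem_map.1 hS'
    rcases row_cases S with rfl | ⟨n, hn, -, hn3, -⟩
    · exact absurd (mem_of_mem_tailRow hx) (Finset.notMem_empty _)
    rcases row_cases R with rfl | ⟨m, hm, hm2, hm3, -⟩
    · exact absurd (hT.1 S hS x (mem_of_mem_tailRow hx)).1 (Finset.notMem_empty _)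
    have key : ∀ y ∈ S, y ∈ tailRow R := fun y hy => by
      obtain ⟨h1, z, h2, h3⟩ := hT.1 S hS y hy
      exact (hm3 y).2 ⟨h1, (hm2 z h2).trans_lt h3⟩
    exact ⟨key x (mem_of_mem_tailRow hx), n, key n hn, ((hn3 x).1 hx).2⟩

theorem tabColumn_empty_cons {T : List (Finset A)} (hT : Nested (∅ :: T)) (j : ℕ) :
    tabColumn (∅ :: T) j = [] := by
  rw [List.eq_nil_iff_forall_not_mem]
  intro x hx
  obtain ⟨S, hS, hx⟩ := mem_of_mem_tabColumn hx
  rcases List.mem_cons.1 hS with rfl | hS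
  · exact absurd hx (Finset.notMem_empty _)
  · exact absurd (hT.1 S hS x hx).1 (Finset.notMem_empty _)

theorem tabColumn_zero_cons {R : Finset A} {m : A} (hm : (R.sort (· ≤ ·))[0]? = some m)
    (T : List (Finset A)) : tabColumn (R :: T) 0 = m :: tabColumn T 0 := by
  simp only [tabColumn]
  rw [List.filterMap_cons_some (b := m) (by exact hm)]

theorem Nested.lt_of_mem_tabColumn {R : Finset A} {T : List (Finset A)} (hT : Nested (R :: T))
    {m : A} (hm : ∀ x ∈ R, m ≤ x) {j : ℕ} {x : A} (hx : x ∈ tabColumn T j) : m < x := by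
  obtain ⟨S, hS, hx⟩ := mem_of_mem_tabColumn hx
  obtain ⟨-, z, h2, h3⟩ := hT.1 S hS x hx
  exact (hm z h2).trans_lt h3

theorem Nested.pairwise_tabColumn_zero {T : List (Finset A)} (hT : Nested T) :
    (tabColumn T 0).Pairwise (· < ·) := by
  induction T with
  | nil => exact List.Pairwise.nil
  | cons R T ih =>
    rcases row_cases R with rfl | ⟨m, hm, hm2, -, hm4⟩
    · rw [tabColumn_empty_cons hT]
      exact List.Pairwise.nil
    · rw [tabColumn_zero_cons hm4, List.pairwise_cons]
      exact ⟨fun x hx => hT.lt_of_mem_tabColumn hm2 hx, ih hT.2⟩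

theorem Nested.sort_firstColumn {T : List (Finset A)} (hT : Nested T) :
    (firstColumn T).sort (· ≥ ·) = (tabColumn T 0).reverse := by
  have hp := List.pairwise_reverse.2 hT.pairwise_tabColumn_zero
  rw [firstColumn, ← List.toFinset_reverse]
  exact (List.toFinset_sort _ (hp.imp ne_of_gt)).2 (hp.imp le_of_lt)

/-! ### Chains in a tableau and removal of its first column. -/

theorem Dec_nil_succ {p : A → Prop} {k : ℕ} : ¬ Dec ([] : List A) p (k + 1) := by
  rintro ⟨s, h1, -, -, h4⟩
  rw [List.sublist_nil] at h1
  subst h1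
  simp at h4

theorem Dec.zero (w : List A) (p : A → Prop) : Dec w p 0 :=
  ⟨[], by simp, by simp, by simp, rfl⟩

/-- The first column is the longest chain. -/
theorem Chain.dec_tabColumn_zero {T : List (Finset A)} (hT : Nested T) {J I : A → Prop}
    (hI : Low I) {k : ℕ} (h : Chain T J I k) : Dec (tabColumn T 0).reverse I k := by
  induction T generalizing J k with
  | nil =>
    cases k with
    | zero => exact Dec.zero _ _
    | succ k => exact h.elim
  | cons R T ih =>
    cases k with
    | zero => exact Dec.zero _ _
    | succ k =>
      obtain ⟨z, h1, h2, -, h4⟩ := h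
      rcases row_cases R with rfl | ⟨m, hm, hm2, -, hm4⟩
      · exact absurd h1 (Finset.notMem_empty _)
      · rw [tabColumn_zero_cons hm4, List.reverse_cons, Dec_concat]
        -- The letter `z` of the chain is replaced by the smallest letter of its row, which stays in
        -- the lower set `I`; the bound `J` may be lost.
        refine Or.inr ⟨hI _ _ (hm2 z h1) h2, (ih hT.2 h4).imp fun x hx hIx => ⟨hIx, ?_⟩⟩
        exact hT.lt_of_mem_tabColumn hm2 (List.mem_reverse.1 hx)

/-- Each letter of the first column is the minimum of its row. A letter skipped by the subword costs
nothing, because a chain in the upper rows can be moved down one row. -/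
theorem Chain.of_dec_tabColumn_zero {T : List (Finset A)} (hT : Nested T) {J I : A → Prop}
    {k : ℕ} (h : Dec (tabColumn T 0).reverse (fun x => I x ∧ ¬ J x) k) : Chain T J I k := by
  induction T generalizing J k with
  | nil =>
    cases k with
    | zero => exact Chain.zero _ _ _
    | succ k => exact absurd h Dec_nil_succ
  | cons R T ih =>
    cases k with
    | zero => exact Chain.zero _ _ _
    | succ k =>
      rcases row_cases R with rfl | ⟨m, hm, hm2, -, hm4⟩
      · rw [tabColumn_empty_cons hT] at h
        exact absurd h Dec_nil_succ
      · rw [tabColumn_zero_cons hm4, List.reverse_cons, Dec_concat] at h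
        rcases h with h | ⟨⟨h1, h2⟩, h3⟩
        · exact hT.chain_cons (ih hT.2 h)
        · exact ⟨m, hm, h1, h2, ih hT.2 (h3.imp fun x _ hx => ⟨hx.1.1, not_le_of_gt hx.2⟩)⟩

/-- Chains after removal of the first column. -/
theorem Chain_iff_tailRow {T : List (Finset A)} (hT : Nested T) {J I : A → Prop} (hI : Low I)
    (hJ : Low J) (k : ℕ) : Chain T J I k ↔ ∃ L : A → Prop, Low L ∧ ∃ i j, i + j = k ∧
      Dec (tabColumn T 0).reverse (fun x => (I x ∧ ¬ J x) ∧ ¬ L x) i ∧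
      Chain (T.map tailRow) J (fun x => I x ∧ L x) j := by
  constructor
  · intro h
    induction T generalizing J k with
    | nil =>
      cases k with
      | zero => exact ⟨_, Low.false, 0, 0, rfl, Dec.zero _ _, Chain.zero _ _ _⟩
      | succ k => exact h.elim
    | cons R T ih =>
      cases k with
      | zero => exact ⟨_, Low.false, 0, 0, rfl, Dec.zero _ _, Chain.zero _ _ _⟩
      | succ k =>
        have hc := h.dec_tabColumn_zero hT hI
        obtain ⟨z, h1, h2, h3, h4⟩ := h
        rcases row_cases R with rfl | ⟨m, hm, hm2, hm3, hm4⟩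
        · exact absurd h1 (Finset.notMem_empty _)
        · have hmt : ∀ x ∈ (tabColumn (R :: T) 0).reverse, m ≤ x := fun x hx => by
            rw [List.mem_reverse, tabColumn_zero_cons hm4, List.mem_cons] at hx
            rcases hx with rfl | hx
            · exact le_rfl
            · exact (hT.lt_of_mem_tabColumn hm2 hx).le
          have hsub : (tabColumn T 0).reverse.Sublist (tabColumn (R :: T) 0).reverse := by
            rw [tabColumn_zero_cons hm4, List.reverse_cons]
            exact List.sublist_append_left _ _
          rcases (hm2 z h1).eq_or_lt with rfl | hlt
          -- Here `z` is the smallest letter of `R`: the whole chain is replaced by letters of the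
          -- first column. These are all `≥ z`, hence outside `J`, so `J` itself serves as the cut.
          · exact ⟨_, hJ, k + 1, 0, rfl, hc.imp fun x hx hIx => ⟨⟨hIx, fun hJx =>
              h3 (hJ _ _ (hmt x hx) hJx)⟩, fun hJx => h3 (hJ _ _ (hmt x hx) hJx)⟩,
              Chain.zero _ _ _⟩
          · have hlow : Low (fun x => x ≤ z) := fun x y hxy hy => hxy.trans hy
            have hJz : ∀ x, ¬ x ≤ z → ¬ J x := fun x hx hJx =>
              h3 (hJ _ _ (le_of_not_ge hx) hJx)
            obtain ⟨L, hL, i, j, rfl, g1, g2⟩ := ih hT.2 hlow k h4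
            cases j with
            | zero =>
              -- The rest of the chain lies in the first column above `z`; the cut is made at `z`,
              -- which alone forms the chain in the shortened rows.
              refine ⟨_, hlow, i, 1, rfl, (g1.imp fun x _ hx => ⟨⟨hx.1.1, hJz x hx.1.2⟩,
                hx.1.2⟩).sublist hsub, z, (hm3 z).2 ⟨h1, hlt⟩, ⟨h2, le_rfl⟩, h3,
                Chain.zero _ _ _⟩
            | succ j =>
              -- The next letter of the shortened chain exceeds `z` and lies in the lower set `L`.
              have hLz : L z := by
                cases T with
                | nil => exact g2.elim
                | cons S T =>
                  obtain ⟨y, -, y2, y3, -⟩ := g2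
                  exact hL _ _ (le_of_not_ge y3) y2.2
              exact ⟨L, hL, i, j + 2, by omega, (g1.imp fun x _ hx => ⟨⟨hx.1.1, hJz x hx.1.2⟩,
                hx.2⟩).sublist hsub, z, (hm3 z).2 ⟨h1, hlt⟩, ⟨h2, hLz⟩, h3, g2⟩
  · rintro ⟨L, hL, i, j, rfl, h1, h2⟩
    induction T generalizing J j with
    | nil =>
      cases j with
      | zero => exact Chain.of_dec_tabColumn_zero hT (h1.imp fun x _ hx => hx.1)
      | succ j => exact h2.elim
    | cons R T ih =>
      cases j with
      | zero => exact Chain.of_dec_tabColumn_zero hT (h1.imp fun x _ hx => hx.1)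
      | succ j =>
        obtain ⟨z, z1, z2, z3, z4⟩ := h2
        rcases row_cases R with rfl | ⟨m, hm, hm2, hm3, hm4⟩
        · exact absurd (mem_of_mem_tailRow z1) (Finset.notMem_empty _)
        · have hlow : Low (fun x => x ≤ z) := fun x y hxy hy => hxy.trans hy
          refine ⟨z, mem_of_mem_tailRow z1, z2.1, z3, ih hT.2 hlow j ?_ z4⟩
          have hLz : ∀ x, ¬ L x → ¬ x ≤ z := fun x hx hxz => hx (hL _ _ hxz z2.2)
          -- The smallest letter of `R` is below `z`, hence in `L`, so the subword cannot use it.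
          have h1' : Dec (tabColumn T 0).reverse (fun x => (I x ∧ ¬ J x) ∧ ¬ L x) i := by
            cases i with
            | zero => exact Dec.zero _ _
            | succ i =>
              rw [tabColumn_zero_cons hm4, List.reverse_cons, Dec_concat] at h1
              rcases h1 with h1 | ⟨h1, -⟩
              · exact h1
              · exact absurd ((hm3 z).1 z1).2.le (hLz m h1.2)
          exact h1'.imp fun x _ hx => ⟨⟨hx.1.1, hLz x hx.2⟩, hx.2⟩

/-- Word counterpart of `Chain_iff_tailRow`: a decreasing subword takes its larger letters from the
first column and the smaller ones from the remaining columns. Both sides thus satisfy the same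
recursion. -/
theorem Dec_column_append {c : List A} {u : List A} {T' : List (Finset A)} {J I : A → Prop}
    (hI : Low I) (hu : ∀ I : A → Prop, Low I → ∀ k,
      Dec u (fun x => I x ∧ ¬ J x) k ↔ Chain T' J I k) (k : ℕ) :
    Dec (c ++ u) (fun x => I x ∧ ¬ J x) k ↔ ∃ L : A → Prop, Low L ∧ ∃ i j, i + j = k ∧
      Dec c (fun x => (I x ∧ ¬ J x) ∧ ¬ L x) i ∧ Chain T' J (fun x => I x ∧ L x) j := by
  have hlow : ∀ L : A → Prop, Low L → Low (fun x => I x ∧ L x) := fun L hL x y hxy h =>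
    ⟨hI _ _ hxy h.1, hL _ _ hxy h.2⟩
  constructor
  · intro h
    obtain ⟨L, hL, i, j, hij, h1, h2⟩ := h.exists_of_append
    refine ⟨L, hL, i, j, hij, h1, (hu _ (hlow L hL) j).1 (h2.imp fun x _ hx => ?_)⟩
    exact ⟨⟨hx.1.1, hx.2⟩, hx.1.2⟩
  · rintro ⟨L, hL, i, j, rfl, h1, h2⟩
    refine Dec.append hL h1 (((hu _ (hlow L hL) j).2 h2).imp fun x _ hx => ?_)
    exact ⟨⟨hx.1.1, hx.2⟩, hx.1.2⟩

/-- Induction on the number of columns, comparing `Chain_iff_tailRow` with `Dec_column_append`. Any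
`n` beyond the width is allowed, since further columns are empty. -/
theorem Dec_reading_iff_Chain {T : List (Finset A)} (hT : Nested T) {n : ℕ} (hn : width T ≤ n)
    {I J : A → Prop} (hI : Low I) (hJ : Low J) (k : ℕ) :
    Dec ((List.range n).flatMap fun j => (tabColumn T j).reverse) (fun x => I x ∧ ¬ J x) k ↔
      Chain T J I k := by
  induction n generalizing T I k with
  | zero =>
    cases k with
    | zero => exact ⟨fun _ => Chain.zero _ _ _, fun _ => Dec.zero _ _⟩
    | succ k =>
      refine ⟨fun h => absurd h Dec_nil_succ, fun h => ?_⟩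
      cases T with
      | nil => exact h.elim
      | cons R T =>
        obtain ⟨z, hz, -⟩ := h
        have : R = ∅ := Finset.card_eq_zero.1 (Nat.le_zero.1 hn)
        rw [this] at hz
        exact absurd hz (Finset.notMem_empty _)
  | succ n ih =>
    have hw : width (T.map tailRow) ≤ n := by
      cases T with
      | nil => exact Nat.zero_le _
      | cons R T =>
        change (tailRow R).card ≤ n
        have h1 : R.card ≤ n + 1 := hn
        rw [← Finset.length_sort (· ≤ ·), sort_tailRow, List.length_tail, Finset.length_sort]
        omega
    rw [Chain_iff_tailRow hT hI hJ, ← Dec_column_append hI fun I hI k =>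
      ih hT.map_tailRow hw hI k]
    simp only [tabColumn_map_tailRow]
    rw [List.range_succ_eq_map, List.flatMap_cons, List.flatMap_map]

/-- The first column of the `N`-tableau of `w` is `w · ∅`. -/
theorem eta_mu (w : List A) : eta (mu w) = act w ∅ := by
  have hT := (good_nTableau w).nested
  rw [eta, stylN_mu, ← act_sort (firstColumn _), hT.sort_firstColumn]
  refine act_empty_eq_of_Dec fun I hI k => ?_
  have hch := Dec_iff_Chain w hI Low.false k
  simp only [not_false_eq_true, and_true] at hch
  rw [hch]
  exact ⟨fun h => Chain.of_dec_tabColumn_zero hT (by simpa using h),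
    fun h => h.dec_tabColumn_zero hT hI⟩

/-- The column-reading word of the `N`-tableau of `x` represents `x`. -/
theorem mu_eta_append_wWord (x : Styl A) : mu ((eta x).sort (· ≥ ·) ++ wWord x) = x := by
  obtain ⟨w, rfl⟩ := mu_surjective x
  have hT := (good_nTableau w).nested
  -- The bound `width - 1 + 1` also covers the empty tableau, read as one empty column.
  have hr : (eta (mu w)).sort (· ≥ ·) ++ wWord (mu w) =
      (List.range (width (nTableau w) - 1 + 1)).flatMap
        fun j => (tabColumn (nTableau w) j).reverse := by
    rw [eta, wWord, stylN_mu, hT.sort_firstColumn, restReading,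
      List.range_eq_range', List.range'_succ, List.flatMap_cons]
  rw [hr]
  refine mu_eq_of_Dec fun I J hI hJ k => ?_
  rw [Dec_reading_iff_Chain hT (by omega) hI hJ, Dec_iff_Chain w hI hJ]

end Reading

/-! ### Letters fixing an element of the stylic monoid -/

section Fixing

variable {A : Type*} [LinearOrder A]

theorem eta_mu_mul (w : List A) (x : Styl A) : eta (mu w * x) = act w (eta x) := by
  obtain ⟨v, rfl⟩ := mu_surjective x
  rw [← mu_append, eta_mu, eta_mu, act_append]

theorem eta_mu_singleton_mul (a : A) (x : Styl A) : eta (mu [a] * x) = colInsert a (eta x) :=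
  eta_mu_mul [a] x

/-- `x` has a representative starting with the decreasing word `η(x)`, so every column it produces
already contains `a`, and inserting `a` changes nothing. -/
theorem mu_singleton_mul {a : A} {x : Styl A} (ha : a ∈ eta x) : mu [a] * x = x := by
  conv_rhs => rw [← mu_eta_append_wWord x]
  conv_lhs => rw [← mu_eta_append_wWord x]
  rw [← mu_append, mu_eq_iff]
  intro γ
  rw [act_append, act_append]
  refine colInsert_of_mem (mem_act_of_pairwise (eta x).sortedGT_sort.pairwise ?_ _)
  rwa [Finset.mem_sort]

/-! ### Longest decreasing subwords and counts of letters. -/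

open Classical in
theorem le_card_eta (w : List A) (k : ℕ) : k ≤ (eta (mu w)).card ↔ Dec w (fun _ => True) k := by
  rw [Dec_iff_card w Low.true, eta_mu]
  simp

theorem card_eta_le {u v : List A} (h : u.Sublist v) :
    (eta (mu u)).card ≤ (eta (mu v)).card :=
  (le_card_eta v _).2 (((le_card_eta u _).1 le_rfl).sublist h)

theorem card_le_card_eta_append_sort (w : List A) (γ : Finset A) :
    γ.card ≤ (eta (mu (w ++ γ.sort (· ≥ ·)))).card := by
  refine le_trans ?_ (card_eta_le (List.sublist_append_right _ _))
  rw [eta_mu, act_sort]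

theorem card_filter_colInsert (a : A) (δ : Finset A) {I : A → Prop} [DecidablePred I] (hI : Low I)
    (k : ℕ) : k + 1 ≤ ((colInsert a δ).filter I).card ↔
      k + 1 ≤ (δ.filter I).card ∨ (I a ∧ k ≤ (δ.filter (fun x => I x ∧ x < a)).card) := by
  convert card_colInsert a δ hI k

theorem card_filter_colInsert_le (a : A) (δ : Finset A) (c : A) :
    (δ.filter fun x => x ≤ c).card ≤ ((colInsert a δ).filter fun x => x ≤ c).card := by
  have hlow : Low (fun x : A => x ≤ c) := fun x y hxy hy => hxy.trans hy
  rcases h : (δ.filter fun x => x ≤ c).card with _ | k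
  · exact Nat.zero_le _
  · exact (card_filter_colInsert a δ hlow k).2 (Or.inl h.ge)

variable [Fintype A]

/-! ### Right multiplication, by reversal of the alphabet. -/

theorem stylTheta_mul (x y : Styl A) : stylTheta (x * y) = stylTheta y * stylTheta x := by
  obtain ⟨u, rfl⟩ := mu_surjective x
  obtain ⟨v, rfl⟩ := mu_surjective y
  rw [← mu_append, stylTheta_mu, stylTheta_mu, stylTheta_mu, wordTheta_append, mu_append]

theorem stylTheta_stylTheta (x : Styl A) : stylTheta (stylTheta x) = x := by
  obtain ⟨u, rfl⟩ := mu_surjective x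
  rw [stylTheta_mu, stylTheta_mu, wordTheta_wordTheta]

theorem stylTheta_mu_singleton (a : A) : stylTheta (mu [a]) = mu [letterRev a] :=
  stylTheta_mu [a]

/-- The set of letters fixing `x` by multiplication on the right. -/
noncomputable def rightEta (x : Styl A) : Finset A := colTheta (eta (stylTheta x))

theorem mem_rightEta {a : A} {x : Styl A} :
    a ∈ rightEta x ↔ letterRev a ∈ eta (stylTheta x) := by
  rw [rightEta, colTheta, Finset.mem_image]
  constructor
  · rintro ⟨b, hb, rfl⟩
    rwa [letterRev_letterRev]
  · exact fun h => ⟨_, h, letterRev_letterRev a⟩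

theorem mul_mu_singleton {a : A} {x : Styl A} (ha : a ∈ rightEta x) : x * mu [a] = x := by
  have := congrArg stylTheta (mu_singleton_mul (mem_rightEta.1 ha))
  rwa [stylTheta_mul, stylTheta_stylTheta, stylTheta_mu_singleton, letterRev_letterRev] at this

theorem mul_mu_of_subset {x : Styl A} {u : List A} (hu : ∀ a ∈ u, a ∈ rightEta x) :
    x * mu u = x := by
  induction u with
  | nil => exact mul_one x
  | cons a u ih =>
    rw [← List.singleton_append, mu_append, ← mul_assoc, mul_mu_singleton (hu a (by simp)),
      ih fun b hb => hu b (by simp [hb])]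

theorem mem_rightEta_mul_of_lt {a b : A} {x : Styl A} (ha : a ∈ rightEta x) (hab : b < a) :
    a ∈ rightEta (x * mu [b]) := by
  rw [mem_rightEta] at ha ⊢
  rw [stylTheta_mul, stylTheta_mu_singleton, eta_mu_singleton_mul]
  exact mem_colInsert_of_lt ha (letterRev_lt.2 hab)

-- Image of `Dec_iff_card` under `θ`, which preserves decreasing subwords and turns upper sets of
-- letters into lower sets.
open Classical in
theorem Dec_iff_card_rightEta (w : List A) {J : A → Prop} (hJ : Low J) (k : ℕ) :
    Dec w (fun x => ¬ J x) k ↔ k ≤ ((rightEta (mu w)).filter fun x => ¬ J x).card := by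
  have hI : Low (fun x : A => ¬ J (letterRev x)) := fun x y hxy hy hx => by
    refine hy (hJ _ _ ?_ hx)
    exact le_of_not_gt fun hlt => not_lt_of_ge hxy (letterRev_lt.1 hlt)
  have h1 : Dec w (fun x => ¬ J x) k ↔ Dec (wordTheta w) (fun x => ¬ J (letterRev x)) k := by
    refine ⟨Dec.theta, fun h => ?_⟩
    have := h.theta
    rw [wordTheta_wordTheta] at this
    exact this.imp fun x _ hx => by rwa [letterRev_letterRev] at hx
  have hinj : Function.Injective (letterRev : A → A) :=
    Function.LeftInverse.injective letterRev_letterRev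
  rw [h1, Dec_iff_card _ hI, rightEta, colTheta, stylTheta_mu, eta_mu, Finset.filter_image,
    Finset.card_image_of_injective _ hinj]
  convert Iff.rfl

theorem card_rightEta (x : Styl A) : (rightEta x).card = (eta x).card := by
  classical
  obtain ⟨w, rfl⟩ := mu_surjective x
  have h : ∀ k, k ≤ (rightEta (mu w)).card ↔ k ≤ (eta (mu w)).card := fun k => by
    have := Dec_iff_card_rightEta w (J := fun _ => False) Low.false k
    rw [le_card_eta]
    simp only [not_false_eq_true, Finset.filter_true] at this
    exact this.symm
  exact le_antisymm ((h _).1 le_rfl) ((h _).2 le_rfl)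

/-- Multiplication by a letter that does not fix `w`, followed by a word and by the letters that
fix `w`, creates a longer decreasing subword. -/
theorem card_eta_lt_of_notMem {w : List A} {a : A} (ha : a ∉ rightEta (mu w)) (u : List A) :
    (eta (mu w)).card <
      (eta (mu (w ++ a :: (u ++ (rightEta (mu w)).sort (· ≥ ·))))).card := by
  classical
  set γ := rightEta (mu w) with hγ
  have hlow : Low (fun x : A => x ≤ a) := fun x y hxy hy => hxy.trans hy
  rw [← card_rightEta, ← hγ, Nat.lt_iff_add_one_le, le_card_eta]
  -- The longer subword consists of `q`, taken in `w` with as many letters above `a` as `γ` has,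
  -- then `a`, then the letters of `γ` below `a`. As `a ∉ γ`, its length is `|γ| + 1`.
  obtain ⟨q, q1, q2, q3, q4⟩ := (Dec_iff_card_rightEta w hlow _).2 le_rfl
  replace q4 : q.length = (γ.filter fun x => ¬ x ≤ a).card := by
    rw [q4]
    congr
  set r := (γ.sort (· ≥ ·)).filter (fun x => decide (x < a)) with hr
  have hrlt : ∀ x ∈ r, x < a := fun x hx => by simpa using (List.mem_filter.1 hx).2
  have hrlen : r.length = (γ.filter fun x => x ≤ a).card := by
    rw [← List.toFinset_card_of_nodup ((Finset.sort_nodup _ _).filter _)]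
    congr 1
    ext x
    simp only [List.mem_toFinset, List.mem_filter, Finset.mem_sort, decide_eq_true_iff,
      Finset.mem_filter, and_congr_right_iff]
    exact fun hx => ⟨le_of_lt, fun h => lt_of_le_of_ne h fun he => ha (he ▸ hx)⟩
  refine ⟨q ++ a :: r, q1.append (List.Sublist.cons_cons a
    (List.filter_sublist.trans (List.sublist_append_right _ _))), ?_, fun _ _ => trivial, ?_⟩
  · refine List.pairwise_append.2 ⟨q2, List.pairwise_cons.2 ⟨hrlt,
      γ.sortedGT_sort.pairwise.filter _⟩, fun x hx y hy => ?_⟩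
    have hax := lt_of_not_ge (q3 x hx)
    rcases List.mem_cons.1 hy with rfl | hy
    · exact hax
    · exact (hrlt y hy).trans hax
  · rw [List.length_append, List.length_cons, q4, hrlen,
      ← Finset.card_filter_add_card_filter_not (s := γ) fun x => x ≤ a]
    omega

/-- A statistic on columns that increases under insertion of letters. -/
def potential (δ : Finset A) : ℕ := ∑ c : A, (δ.filter fun x => x ≤ c).card

theorem potential_le_colInsert (a : A) (δ : Finset A) : potential δ ≤ potential (colInsert a δ) :=
  Finset.sum_le_sum fun c _ => card_filter_colInsert_le a δ c

theorem potential_lt_colInsert {a : A} {δ : Finset A} (ha : a ∉ δ) :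
    potential δ < potential (colInsert a δ) := by
  refine Finset.sum_lt_sum (fun c _ => card_filter_colInsert_le a δ c)
    -- The count strictly increases at `c = a`: no letter of `δ` equals `a`, so those `≤ a` are kept
    -- and `a` is added.
    ⟨a, Finset.mem_univ a, (card_filter_colInsert a δ (fun x y hxy hy => hxy.trans hy) _).2
      (Or.inr ⟨le_rfl, Finset.card_le_card fun x hx => ?_⟩)⟩
  rw [Finset.mem_filter] at hx ⊢
  exact ⟨hx.1, hx.2, lt_of_le_of_ne hx.2 fun he => ha (he ▸ hx.1)⟩

theorem potential_le (δ : Finset A) : potential δ ≤ Fintype.card A * Fintype.card A := by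
  refine (Finset.sum_le_sum (g := fun _ => Fintype.card A) fun c _ => Finset.card_le_univ _).trans ?_
  simp

end Fixing

/-! ### The products `∏ (1 - a)` in the stylic algebra -/

section Algebra

open MonoidAlgebra

variable {A : Type*} [LinearOrder A] (K : Type*) [Field K]

/-- The product of the `1 - a`, for the letters `a` of a word. -/
noncomputable def oneSubProd (l : List A) : MonoidAlgebra K (Styl A) :=
  (l.map fun a => 1 - ofWord K [a]).prod

theorem oneSubProd_nil : oneSubProd K ([] : List A) = 1 := rfl

theorem oneSubProd_cons (a : A) (l : List A) :
    oneSubProd K (a :: l) = (1 - ofWord K [a]) * oneSubProd K l := by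
  simp [oneSubProd]

theorem ofWord_append (u v : List A) : ofWord K (u ++ v) = ofWord K u * ofWord K v := by
  rw [ofWord, mu_append, map_mul, ofWord, ofWord]

theorem ofWord_mul_of (u : List A) (x : Styl A) :
    ofWord K u * of K _ x = of K _ (mu u * x) := by
  rw [map_mul, ofWord]

theorem of_mul_ofWord (u : List A) (x : Styl A) :
    of K _ x * ofWord K u = of K _ (x * mu u) := by
  rw [map_mul, ofWord]

theorem prod_ofWord (l : List A) : (l.map fun a => ofWord K [a]).prod = ofWord K l := by
  induction l with
  | nil => exact (map_one (of K (Styl A))).symm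
  | cons a l ih => rw [List.map_cons, List.prod_cons, ih, ← ofWord_append, List.singleton_append]

/-- The subspace spanned by the elements of the stylic monoid in a given set. -/
noncomputable def spanOf (s : Set (Styl A)) : Submodule K (MonoidAlgebra K (Styl A)) :=
  Submodule.span K (of K (Styl A) '' s)

variable {K}

theorem of_mem_spanOf {s : Set (Styl A)} {x : Styl A} (hx : x ∈ s) : of K _ x ∈ spanOf K s :=
  Submodule.subset_span ⟨x, hx, rfl⟩

theorem spanOf_induction {s : Set (Styl A)} (f : MonoidAlgebra K (Styl A) →ₗ[K]
    MonoidAlgebra K (Styl A)) {N : Submodule K (MonoidAlgebra K (Styl A))}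
    (h : ∀ x ∈ s, f (of K _ x) ∈ N) {y : MonoidAlgebra K (Styl A)} (hy : y ∈ spanOf K s) :
    f y ∈ N := by
  have : spanOf K s ≤ N.comap f := by
    rw [spanOf, Submodule.span_le]
    rintro _ ⟨x, hx, rfl⟩
    exact h x hx
  exact this hy

theorem mem_spanOf_univ (y : MonoidAlgebra K (Styl A)) : y ∈ spanOf K (Set.univ : Set (Styl A)) := by
  rw [spanOf, Set.image_univ]
  have h := (MonoidAlgebra.basis (Styl A) K).mem_span y
  convert h using 3
  ext x
  rw [MonoidAlgebra.basis_apply, of_apply]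

theorem linearMap_eq_zero (f : MonoidAlgebra K (Styl A) →ₗ[K] MonoidAlgebra K (Styl A))
    {s : Set (Styl A)} (h : ∀ x ∈ s, f (of K _ x) = 0) {y : MonoidAlgebra K (Styl A)}
    (hy : y ∈ spanOf K s) : f y = 0 :=
  (Submodule.mem_bot K).1 (spanOf_induction f (N := ⊥)
    (fun x hx => (Submodule.mem_bot K).2 (h x hx)) hy)

/-- Inserting a letter larger than `a` leaves `a` in the column. -/
theorem oneSubProd_mul_mem_spanOf {a : A} {l : List A} (hl : ∀ b ∈ l, a < b)
    {y : MonoidAlgebra K (Styl A)} (hy : y ∈ spanOf K {x | a ∈ eta x}) :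
    oneSubProd K l * y ∈ spanOf K {x | a ∈ eta x} := by
  induction l with
  | nil => rwa [oneSubProd_nil, one_mul]
  | cons b l ih =>
    rw [oneSubProd_cons, mul_assoc, sub_mul, one_mul]
    have hm := ih fun c hc => hl c (by simp [hc])
    refine Submodule.sub_mem _ hm (spanOf_induction (LinearMap.mulLeft K _) (fun x hx => ?_) hm)
    rw [LinearMap.mulLeft_apply, ofWord_mul_of]
    refine of_mem_spanOf ?_
    rw [Set.mem_ofPred_eq, eta_mu_singleton_mul]
    exact mem_colInsert_of_lt hx (hl b (by simp))

/-- The product of the `1 - a`, in increasing order, kills the elements whose first column has one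
of the letters `a`. -/
theorem oneSubProd_mul_eq_zero {l : List A} (hl : l.Pairwise (· < ·)) {a : A} (ha : a ∈ l)
    {x : Styl A} (hx : a ∈ eta x) : oneSubProd K l * of K _ x = 0 := by
  induction l with
  | nil => simp at ha
  | cons b l ih =>
    rw [List.pairwise_cons] at hl
    rw [oneSubProd_cons, mul_assoc]
    rcases List.mem_cons.1 ha with rfl | ha
    · refine linearMap_eq_zero (LinearMap.mulLeft K _) (fun z hz => ?_)
        (oneSubProd_mul_mem_spanOf hl.1 (of_mem_spanOf (K := K) hx))
      rw [LinearMap.mulLeft_apply, sub_mul, one_mul, ofWord_mul_of, mu_singleton_mul hz, sub_self]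
    · rw [ih hl.2 ha, mul_zero]

/-- Unitriangularity: in every term other than `x`, the first letter applied is outside `η(x)` and
strictly raises the potential, and the later ones do not lower it. -/
theorem oneSubProd_mul_of_sub_mem [Fintype A] {l : List A} {x : Styl A} (hl : ∀ a ∈ l, a ∉ eta x) :
    oneSubProd K l * of K _ x - of K _ x ∈
      spanOf K {y : Styl A | potential (eta x) < potential (eta y)} := by
  induction l with
  | nil =>
    rw [oneSubProd_nil, one_mul, sub_self]
    exact Submodule.zero_mem _
  | cons a l ih =>
    have h := ih fun b hb => hl b (by simp [hb])
    have e : oneSubProd K (a :: l) * of K _ x - of K _ x =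
        (oneSubProd K l * of K _ x - of K _ x) - ofWord K [a] * of K _ x -
          ofWord K [a] * (oneSubProd K l * of K _ x - of K _ x) := by
      rw [oneSubProd_cons, sub_mul, one_mul, sub_mul, mul_assoc, mul_sub]
      abel
    rw [e]
    refine Submodule.sub_mem _ (Submodule.sub_mem _ h ?_)
      (spanOf_induction (LinearMap.mulLeft K _) (fun y hy => ?_) h)
    · rw [ofWord_mul_of]
      refine of_mem_spanOf ?_
      rw [Set.mem_ofPred_eq, eta_mu_singleton_mul]
      exact potential_lt_colInsert (hl a (by simp))
    · rw [LinearMap.mulLeft_apply, ofWord_mul_of]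
      refine of_mem_spanOf ?_
      rw [Set.mem_ofPred_eq, eta_mu_singleton_mul]
      exact lt_of_lt_of_le hy (potential_le_colInsert a _)

/-- Linear extension from words `u` to arbitrary `y`; it allows the middle factors `1 - a` to be
treated without expanding them. -/
theorem oneSubProd_mul_of_mul_mul_eq_zero {l m : List A} {x : Styl A}
    (h : ∀ u, oneSubProd K l * of K _ (x * mu u * mu m) = 0) (y : MonoidAlgebra K (Styl A)) :
    oneSubProd K l * of K _ x * y * ofWord K m = 0 := by
  refine linearMap_eq_zero ((LinearMap.mulRight K (ofWord K m)).comp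
    (LinearMap.mulLeft K (oneSubProd K l * of K _ x))) (fun z _ => ?_) (mem_spanOf_univ y)
  obtain ⟨u, rfl⟩ := mu_surjective z
  rw [LinearMap.comp_apply, LinearMap.mulLeft_apply, LinearMap.mulRight_apply, mul_assoc, mul_assoc,
    of_mul_ofWord, ← map_mul, ← mul_assoc, h]

variable [Fintype A]

/-- The product of the `1 - a`, in increasing order, is killed on the left by the elements fixed on
the right by one of the letters `a`. -/
theorem mul_oneSubProd_eq_zero {l : List A} (hl : l.Pairwise (· < ·)) {a : A} (ha : a ∈ l)
    {y : MonoidAlgebra K (Styl A)} (hy : y ∈ spanOf K {x | a ∈ rightEta x}) :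
    y * oneSubProd K l = 0 := by
  induction l generalizing y with
  | nil => simp at ha
  | cons b l ih =>
    rw [List.pairwise_cons] at hl
    rw [oneSubProd_cons, ← mul_assoc]
    rcases List.mem_cons.1 ha with rfl | ha
    · have : y * (1 - ofWord K [a]) = 0 := by
        refine linearMap_eq_zero (LinearMap.mulRight K _) (fun z hz => ?_) hy
        rw [LinearMap.mulRight_apply, mul_sub, mul_one, of_mul_ofWord, mul_mu_singleton hz,
          sub_self]
      rw [this, zero_mul]
    · refine ih hl.2 ha ?_
      rw [mul_sub, mul_one]
      refine Submodule.sub_mem _ hy (spanOf_induction (LinearMap.mulRight K _) (fun x hx => ?_) hy)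
      rw [LinearMap.mulRight_apply, of_mul_ofWord]
      exact of_mem_spanOf (mem_rightEta_mul_of_lt hx (hl.1 a ha))

/-! ### The elements `e_γ` -/

theorem e_eq (γ : Finset A) :
    e K γ = oneSubProd K (γᶜ.sort (· ≤ ·)) * ofWord K (γ.sort (· ≥ ·)) := by
  rw [e, prod_ofWord, oneSubProd]

/-- The decreasing factor of `e_{η(x)}` followed by `w_x` is the column-reading word of `N(x)`,
which represents `x`. -/
theorem basisElt_eq (x : Styl A) :
    basisElt K x = oneSubProd K ((eta x)ᶜ.sort (· ≤ ·)) * of K _ x := by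
  rw [basisElt, e_eq, mul_assoc, ← ofWord_append]
  conv_rhs => rw [← mu_eta_append_wWord x]
  rw [ofWord]
  rw [mu_eta_append_wWord]

theorem oneSubProd_compl_mul_eq_zero {γ : Finset A} {x : Styl A} (h : ¬ eta x ⊆ γ) :
    oneSubProd K (γᶜ.sort (· ≤ ·)) * of K _ x = 0 := by
  obtain ⟨a, ha, haγ⟩ := Finset.not_subset.1 h
  exact oneSubProd_mul_eq_zero γᶜ.sortedLT_sort.pairwise (by simp [haγ]) ha

theorem oneSubProd_compl_mul_eq_zero_of_card_lt {γ : Finset A} {x : Styl A}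
    (h : γ.card < (eta x).card) : oneSubProd K (γᶜ.sort (· ≤ ·)) * of K _ x = 0 :=
  oneSubProd_compl_mul_eq_zero fun hs => not_lt_of_ge (Finset.card_le_card hs) h

theorem e_mul_of (γ : Finset A) (x : Styl A) :
    e K γ * of K _ x =
      oneSubProd K (γᶜ.sort (· ≤ ·)) * of K _ (mu (γ.sort (· ≥ ·)) * x) := by
  rw [e_eq, mul_assoc, ofWord_mul_of]

/-- `e_γ w` is zero or one of the elements `e_γ w_x`. -/
theorem e_mul_of_mem_span (γ : Finset A) (w : Styl A) :
    e K γ * of K _ w ∈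
      Submodule.span K (Set.range fun x : {x : Styl A // eta x = γ} => basisElt K x.1) := by
  rw [e_mul_of]
  set x := mu (γ.sort (· ≥ ·)) * w with hx
  by_cases h : eta x = γ
  · refine Submodule.subset_span ⟨⟨x, h⟩, ?_⟩
    simp only [basisElt_eq, h]
  · have hz : ¬ eta x ⊆ γ := fun hs => by
      refine h (Finset.eq_of_subset_of_card_le hs ?_)
      obtain ⟨u, rfl⟩ := mu_surjective w
      rw [hx, ← mu_append]
      refine le_trans ?_ (card_eta_le (List.sublist_append_left _ _))
      rw [eta_mu, act_sort]
    rw [oneSubProd_compl_mul_eq_zero hz]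
    exact Submodule.zero_mem _

theorem mul_e (y : MonoidAlgebra K (Styl A)) (γ : Finset A) :
    y * e K γ = y * oneSubProd K (γᶜ.sort (· ≤ ·)) * ofWord K (γ.sort (· ≥ ·)) := by
  rw [e_eq, mul_assoc]

theorem basisElt_mul_e_self (x : Styl A) : basisElt K x * e K (rightEta x) = basisElt K x := by
  have key : ∀ l : List A, (∀ a ∈ l, a ∉ rightEta x) →
      basisElt K x * oneSubProd K l * ofWord K ((rightEta x).sort (· ≥ ·)) = basisElt K x := by
    intro l hl
    induction l with
    | nil =>
      rw [oneSubProd_nil, mul_one, basisElt_eq, mul_assoc, of_mul_ofWord,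
        mul_mu_of_subset fun a ha => (Finset.mem_sort _).1 ha]
    | cons a l ih =>
      -- Only the term `1` of the factor `1 - a` survives: since `a` is outside `rightEta x`, every
      -- `x a u γ`, with `γ` this set, has a longer decreasing subword than `x`, and is killed by
      -- the product attached to `η(x)`.
      have hz : basisElt K x * ofWord K [a] * oneSubProd K l *
          ofWord K ((rightEta x).sort (· ≥ ·)) = 0 := by
        rw [basisElt_eq, mul_assoc (oneSubProd K _), of_mul_ofWord]
        refine oneSubProd_mul_of_mul_mul_eq_zero (fun u => ?_) _
        refine oneSubProd_compl_mul_eq_zero_of_card_lt ?_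
        obtain ⟨w, rfl⟩ := mu_surjective x
        rw [← mu_append, ← mu_append, ← mu_append]
        simpa using card_eta_lt_of_notMem (hl a (by simp)) u
      rw [oneSubProd_cons, ← mul_assoc, mul_sub, mul_one, sub_mul, sub_mul, hz, sub_zero]
      exact ih fun b hb => hl b (by simp [hb])
  rw [mul_e]
  exact key _ fun a ha => by simpa using ha

theorem basisElt_mul_e_of_ne {x : Styl A} {γ : Finset A} (h : rightEta x ≠ γ) :
    basisElt K x * e K γ = 0 := by
  -- If the inclusion holds it is strict: every `x u γ` has a decreasing subword of length `|γ| >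
  -- |η(x)|` and is killed from the left. Otherwise a letter fixing `x` on the right occurs in a
  -- factor `1 - a` of `e_γ`, which kills `x`.
  by_cases hs : rightEta x ⊆ γ
  · rw [mul_e, basisElt_eq]
    refine oneSubProd_mul_of_mul_mul_eq_zero (fun u => ?_) _
    refine oneSubProd_compl_mul_eq_zero_of_card_lt ?_
    obtain ⟨w, rfl⟩ := mu_surjective x
    rw [← mu_append, ← mu_append, ← card_rightEta]
    exact (Finset.card_lt_card (hs.ssubset_of_ne h)).trans_le (card_le_card_eta_append_sort _ γ)
  · obtain ⟨a, ha, haγ⟩ := Finset.not_subset.1 hs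
    rw [mul_e, basisElt_eq, mul_assoc (oneSubProd K _), mul_oneSubProd_eq_zero
      γᶜ.sortedLT_sort.pairwise (a := a) (by simp [haγ]) (of_mem_spanOf (K := K) (by exact ha)),
      mul_zero, zero_mul]

/-! ### The basis of the stylic algebra -/

variable (K) in
theorem span_basisElt : Submodule.span K (Set.range (basisElt K : Styl A → _)) = ⊤ := by
  -- Descending induction on the potential, which is at most `|A|²`; `n` bounds the distance to the
  -- top.
  have key : ∀ (n : ℕ) (x : Styl A), Fintype.card A * Fintype.card A < potential (eta x) + n →
      of K _ x ∈ Submodule.span K (Set.range (basisElt K : Styl A → _)) := by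
    intro n
    induction n with
    | zero => exact fun x hx => absurd (potential_le (eta x)) (not_le_of_gt hx)
    | succ n ih =>
      intro x hx
      have hd : basisElt K x - of K _ x ∈
          Submodule.span K (Set.range (basisElt K : Styl A → _)) := by
        have h := oneSubProd_mul_of_sub_mem (K := K) (l := (eta x)ᶜ.sort (· ≤ ·)) (x := x)
          fun a ha => by simpa using ha
        rw [← basisElt_eq] at h
        refine spanOf_induction LinearMap.id (fun y hy => ih y ?_) h
        rw [Set.mem_ofPred_eq] at hy
        omega
      rw [← sub_sub_cancel (basisElt K x) (of K _ x)]
      exact Submodule.sub_mem _ (Submodule.subset_span ⟨x, rfl⟩) hd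
  rw [eq_top_iff]
  intro y _
  exact spanOf_induction LinearMap.id
    (fun x _ => key (Fintype.card A * Fintype.card A + 1) x (by omega)) (mem_spanOf_univ y)

instance : Finite (Styl A) :=
  inferInstanceAs (Finite {f : Finset A → Finset A // f ∈ Styl A})

-- A spanning family indexed by `Styl A` has as many members as the dimension of the algebra.
variable (K) in
theorem linearIndependent_basisElt : LinearIndependent K (basisElt K : Styl A → _) := by
  have := Fintype.ofFinite (Styl A)
  refine linearIndependent_of_top_le_span_of_card_eq_finrank (span_basisElt K).ge ?_
  rw [Module.finrank_eq_card_basis (MonoidAlgebra.basis (Styl A) K)]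

/-- `R` is the stylic algebra or its opposite, so that left and right modules are treated at once as
`K`-spaces. -/
theorem exists_basis_of_span {R M ι : Type*} [Ring R] [AddCommGroup M] [Module R M] [Module K M]
    [SMul K R] [IsScalarTower K R M] (p : Submodule R M) {v : ι → M} (hv : LinearIndependent K v)
    (hmem : ∀ i, v i ∈ p) (hspan : ∀ y ∈ p, y ∈ Submodule.span K (Set.range v)) :
    ∃ b : Module.Basis ι K p, ∀ i, (b i : M) = v i := by
  let f : p →ₗ[K] M := p.subtype.restrictScalars K
  let v' : ι → p := fun i => ⟨v i, hmem i⟩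
  have hfv : f ∘ v' = v := rfl
  have hli : LinearIndependent K v' := LinearIndependent.of_comp f (by rwa [hfv])
  refine ⟨Module.Basis.mk hli ?_, fun i => by rw [Module.Basis.mk_apply]⟩
  intro y _
  have h := hspan y y.2
  rw [← hfv, Set.range_comp, ← Submodule.map_span] at h
  obtain ⟨z, hz, hzy⟩ := h
  rwa [← Subtype.ext (a1 := z) (a2 := y) hzy]

/-! ### Spanning sets of the two modules. -/

theorem basisElt_mem_rightModule (x : Styl A) : basisElt K x ∈ rightModule K (eta x) :=
  (mem_rightModule K).2 ⟨_, rfl⟩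

theorem mem_span_of_mem_rightModule {γ : Finset A} {y : MonoidAlgebra K (Styl A)}
    (hy : y ∈ rightModule K γ) :
    y ∈ Submodule.span K (Set.range fun x : {x : Styl A // eta x = γ} => basisElt K x.1) := by
  obtain ⟨z, rfl⟩ := (mem_rightModule K).1 hy
  exact spanOf_induction (LinearMap.mulLeft K (e K γ)) (fun x _ => e_mul_of_mem_span γ x)
    (mem_spanOf_univ z)

theorem basisElt_mem_leftModule (x : Styl A) : basisElt K x ∈ leftModule K (rightEta x) :=
  (mem_leftModule K).2 ⟨_, basisElt_mul_e_self x⟩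

/-- An element `z e_γ` is computed by expanding `z` in the elements `basisElt K x`, each of which
`e_γ` either fixes or kills. -/
theorem mem_span_of_mem_leftModule {γ : Finset A} {y : MonoidAlgebra K (Styl A)}
    (hy : y ∈ leftModule K γ) :
    y ∈ Submodule.span K (Set.range fun x : {x : Styl A // rightEta x = γ} => basisElt K x.1) := by
  obtain ⟨z, rfl⟩ := (mem_leftModule K).1 hy
  have hz : z ∈ Submodule.span K (Set.range (basisElt K : Styl A → _)) := by
    rw [span_basisElt]
    exact Submodule.mem_top
  induction hz using Submodule.span_induction with
  | mem _ h =>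
    obtain ⟨x, rfl⟩ := h
    by_cases hx : rightEta x = γ
    · subst hx
      rw [basisElt_mul_e_self]
      exact Submodule.subset_span ⟨⟨x, rfl⟩, rfl⟩
    · rw [basisElt_mul_e_of_ne hx]
      exact Submodule.zero_mem _
  | zero =>
    rw [zero_mul]
    exact Submodule.zero_mem _
  | add u v _ _ hu hv =>
    rw [add_mul]
    exact Submodule.add_mem _ (hu ((mem_leftModule K).2 ⟨u, rfl⟩))
      (hv ((mem_leftModule K).2 ⟨v, rfl⟩))
  | smul c u _ hu =>
    rw [smul_mul_assoc]
    exact Submodule.smul_mem _ _ (hu ((mem_leftModule K).2 ⟨u, rfl⟩))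

end Algebra

end Stylic

theorem mainTheorem8 {A : Type*} [Fintype A] [LinearOrder A] (K : Type*) [Field K]
    (γ : Finset A) :
    (∃ b : Module.Basis {x : Stylic.Styl A // Stylic.eta x = γ} K (Stylic.rightModule K γ),
      ∀ x, (b x : MonoidAlgebra K (Stylic.Styl A)) = Stylic.basisElt K x.1) ∧
    (∃ b : Module.Basis
        {x : Stylic.Styl A //
          Stylic.colTheta (Stylic.eta (Stylic.stylTheta x)) = γ} K (Stylic.leftModule K γ),
      ∀ x, (b x : MonoidAlgebra K (Stylic.Styl A)) = Stylic.basisElt K x.1) := by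
  have hli := Stylic.linearIndependent_basisElt (A := A) K
  constructor
  · refine Stylic.exists_basis_of_span _ (hli.comp _ Subtype.val_injective) ?_
      fun y hy => Stylic.mem_span_of_mem_rightModule hy
    rintro ⟨x, rfl⟩
    exact Stylic.basisElt_mem_rightModule x
  · refine Stylic.exists_basis_of_span _ (hli.comp _ Subtype.val_injective) ?_
      fun y hy => Stylic.mem_span_of_mem_leftModule hy
    rintro ⟨x, rfl⟩
    exact Stylic.basisElt_mem_leftModule x
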